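/- Let $p,q>1$ with $\frac1p+\frac1q=1$, let $\Omega\subset\mathbb R^N$ be a domain, and let $Q=\{x_0+\sum_i t_i v_i:\ 0<t_i<1\}$ be an open non-degenerate parallelepiped ($v_1,\dots,v_N$ a basis of $\mathbb R^N$) with $Q\subset\Omega$. Put $\Lambda=\sum_i\mathbb Z v_i$. **Definitions.** * $M_{\Omega,p}(\mathbb R^N)$ is the class of multivalued maps $\beta:\Omega\times\mathbb R^N\to 2^{\mathbb R^N}$ with closed values such that (i) for every closed $C\subset\mathbb R^N$ the set $\{(x,\xi):\beta(x,\xi)\cap C\neq\emptyset\}$ belongs to $\mathcal L(\Omega)\otimes\mathcal B(\mathbb R^N)$ (Lebesgue sets times Borel sets); (ii) $\beta(x,\cdot)$ is maximal monotone for a.e. $x\in\Omega$; (iii) there are constants $m_1,m_2,c_1,c_2\ge 0$ such that, for a.e. $x\in\Omega$, all $\xi\in\mathbb R^N$ and all $\eta\in\beta(x,\xi)$, $\langle\xi,\eta\rangle\ge\max\{\frac{c_1}{p}|\xi|^p-m_1,\ \frac{c_2}{q}|\eta|^q-m_2\}$. * A function $\ell:\mathbb R^N\times\mathbb R^N\to\mathbb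 R$ is a selfdual Lagrangian if it is convex, lower semicontinuous, and $\ell^*(b,a):=\sup_{\xi,\eta}\{\langle b,\xi\rangle+\langle a,\eta\rangle-\ell(\xi,\eta)\}=\ell(a,b)$ for all $a,b$. Its vector field is $\bar\partial \ell(a)=\{b:\ \ell(a,b)-\langle a,b\rangle=0\}$. * $W^{1,p}_\#(Q)$ is the space of $\varphi\in W^{1,p}(Q)$ with $\int_Q\varphi=0$ that are $Q$-periodic (i.e. the $\Lambda$-periodic extension lies in $W^{1,p}_{loc}(\mathbb R^N)$). $L^q_\#(Q;\mathbb R^N)$ is the space of $g\in L^q(Q;\mathbb R^N)$ with $\int_Q\langle g,\nabla\varphi\rangle=0$ for all $\varphi\in W^{1,p}_\#(Q)$. **Theorem.** Let $\beta\in M_{\Omega,p}(\mathbb R^N)$ be $Q$-periodic, that is, $\beta(x+k,\xi)=\beta(x,\xi)$ for all $\xi\in\mathbb R^N$ whenever $x,x+k\in\Omega$ and $k\in\Lambda$. Let $L:\Omega\times\mathbb R^N\times\mathbb R^N\to\mathbb R$ be measurable with respect to $\mathcal L(\Omega)\otimes\mathcal B(\mathbb R^N\times\mathbb R^N)$, with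 $L(x,\cdot,\cdot)$ a selfdual Lagrangian for every $x\in\Omega$, with $\beta(x,\cdot)=\bar\partial L(x,\cdot)$ for a.e. $x\in\Omega$, and such that for some constants $C_0,C_1>0$ and some $n_0,n_1\in L^1(\Omega)$, for a.e. $x\in\Omega$, $$C_0(|a|^p+|b|^q-n_0(x))\le L(x,a,b)\le C_1(|a|^p+|b|^q+n_1(x))\qquad\text{for all }a,b\in\mathbb R^N.$$ For $\xi\in\mathbb R^N$ let $$\beta_{hom}(\xi)=\Big\{\tfrac1{|Q|}\int_Q g(y)\,dy:\ g\in L^q_\#(Q;\mathbb R^N),\ g(y)\in\beta(y,\xi+\nabla\psi(y))\text{ a.e. in }Q\text{ for some }\psi\in W^{1,p}_\#(Q)\Big\}.$$ Then for all $\xi,\eta\in\mathbb R^N$, $\varphi\in W^{1,p}_\#(Q)$ and $g\in L^q_\#(Q;\mathbb R^N)$ the function $x\mapsto L(x,\xi+\nabla\varphi(x),\eta+g(x))$ is integrable on $Q$; for all $\xi,\eta\in\mathbb R^N$ the minimum $$L_{hom}(\xi,\eta)=\min\Big\{\tfrac1{|Q|}\int_Q L\big(x,\xi+\nabla\varphi(x),\eta+g(x)\big)\,dx:\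 \varphi\in W^{1,p}_\#(Q),\ g\in L^q_\#(Q;\mathbb R^N),\ \int_Q g=0\Big\}$$ is attained; $L_{hom}$ is a selfdual Lagrangian on $\mathbb R^N\times\mathbb R^N$; and $\beta_{hom}(\xi)=\bar\partial L_{hom}(\xi)$ for every $\xi\in\mathbb R^N$. -/

import Mathlib

open MeasureTheory
open scoped ContDiff

noncomputable section

namespace PeriodicHom

/-- The Euclidean space `ℝ^N`. -/
abbrev Eu (N : ℕ) : Type := EuclideanSpace ℝ (Fin N)

variable {N : ℕ}

/-! ### Monotone operators and selfdual Lagrangians on `ℝ^N` -/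

/-- A subset of `ℝ^N × ℝ^N` is monotone if `⟨x - y, p - q⟩ ≥ 0` for all `(x, p)`, `(y, q)` in it. -/
def IsMonotoneSet (S : Set (Eu N × Eu N)) : Prop :=
  ∀ z ∈ S, ∀ w ∈ S, 0 ≤ inner ℝ (z.1 - w.1) (z.2 - w.2)

/-- The multivalued map `A` is maximal monotone: its graph is maximal, for set inclusion, among
the monotone sets. -/
def IsMaximalMonotone (A : Eu N → Set (Eu N)) : Prop :=
  Maximal IsMonotoneSet {z : Eu N × Eu N | z.2 ∈ A z.1}

/-- The Fenchel-Legendre dual in both variables,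
`L*(b, a) = sup {⟨b, ξ⟩ + ⟨a, η⟩ - L(ξ, η)}`, with values in the extended reals. -/
def fenchelDual (L : Eu N → Eu N → ℝ) (b a : Eu N) : EReal :=
  ⨆ z : Eu N × Eu N, ((inner ℝ b z.1 + inner ℝ a z.2 - L z.1 z.2 : ℝ) : EReal)

/-- A (finite valued) selfdual Lagrangian: convex, lower semicontinuous, `L*(b, a) = L(a, b)`. -/
structure IsSelfdualLagrangian (L : Eu N → Eu N → ℝ) : Prop where
  convex : ConvexOn ℝ Set.univ (fun z : Eu N × Eu N => L z.1 z.2)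
  lsc : LowerSemicontinuous (fun z : Eu N × Eu N => L z.1 z.2)
  dual_eq : ∀ a b : Eu N, fenchelDual L b a = (L a b : EReal)

/-- The vector field `∂̄L(a) = {b : L(a, b) - ⟨a, b⟩ = 0}`. -/
def selfdualField (L : Eu N → Eu N → ℝ) (a : Eu N) : Set (Eu N) :=
  {b | L a b - inner ℝ a b = 0}

/-! ### State-dependent operators and Lagrangians

Objects depending on `x ∈ Ω` are written as functions on all of `ℝ^N`; only their values at points
of `Ω` are constrained or used. The type `NullMeasurableSpace (Eu N) volume` is `ℝ^N` with the
`σ`-algebra of Lebesgue measurable sets. -/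

/-- The class `M_{Ω,p}(ℝ^N)`, where `q` is the exponent conjugate to `p`. -/
structure MemM (Ω : Set (Eu N)) (p q : ℝ) (β : Eu N → Eu N → Set (Eu N)) : Prop where
  closed_values : ∀ x ∈ Ω, ∀ ξ, IsClosed (β x ξ)
  /-- Measurability of the multivalued map: preimages of closed sets are measurable for the
  product of the Lebesgue `σ`-algebra of `Ω` and the Borel `σ`-algebra of `ℝ^N`. -/
  measurable : ∀ C : Set (Eu N), IsClosed C →
    MeasurableSet {z : NullMeasurableSpace (Eu N) volume × Eu N |
      (z.1 : Eu N) ∈ Ω ∧ (β z.1 z.2 ∩ C).Nonempty}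
  maximal_monotone : ∀ᵐ x ∂(volume.restrict Ω), IsMaximalMonotone (β x)
  bounds : ∃ m₁ m₂ c₁ c₂ : ℝ, 0 ≤ m₁ ∧ 0 ≤ m₂ ∧ 0 ≤ c₁ ∧ 0 ≤ c₂ ∧
    ∀ᵐ x ∂(volume.restrict Ω), ∀ ξ, ∀ η ∈ β x ξ,
      max (c₁ / p * ‖ξ‖ ^ p - m₁) (c₂ / q * ‖η‖ ^ q - m₂) ≤ inner ℝ ξ η

/-- A finite valued `Ω`-dependent selfdual Lagrangian: measurable for the product of the Lebesgue
`σ`-algebra of `Ω` and the Borel `σ`-algebra of `ℝ^N × ℝ^N`, and selfdual for every `x ∈ Ω`. -/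
structure IsSelfdualLagrangianOn (Ω : Set (Eu N)) (L : Eu N → Eu N → Eu N → ℝ) : Prop where
  measurable : ∀ B : Set ℝ, MeasurableSet B →
    MeasurableSet {z : NullMeasurableSpace (Eu N) volume × (Eu N × Eu N) |
      (z.1 : Eu N) ∈ Ω ∧ L z.1 z.2.1 z.2.2 ∈ B}
  selfdual : ∀ x ∈ Ω, IsSelfdualLagrangian (L x)

/-- The two-sided growth condition
`C₀ (|a|^p + |b|^q - n₀(x)) ≤ L(x, a, b) ≤ C₁ (|a|^p + |b|^q + n₁(x))`. -/
def HasGrowth (Ω : Set (Eu N)) (p q : ℝ) (L : Eu N → Eu N → Eu N → ℝ) : Prop :=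
  ∃ C₀ C₁ : ℝ, 0 < C₀ ∧ 0 < C₁ ∧ ∃ n₀ n₁ : Eu N → ℝ,
    IntegrableOn n₀ Ω volume ∧ IntegrableOn n₁ Ω volume ∧
    ∀ᵐ x ∂(volume.restrict Ω), ∀ a b : Eu N,
      C₀ * (‖a‖ ^ p + ‖b‖ ^ q - n₀ x) ≤ L x a b ∧
      L x a b ≤ C₁ * (‖a‖ ^ p + ‖b‖ ^ q + n₁ x)

/-! ### Periodicity -/

/-- The open non-degenerate parallelepiped with corner `x₀` spanned by the basis `v`. -/
def cell (x₀ : Eu N) (v : Module.Basis (Fin N) ℝ (Eu N)) : Set (Eu N) :=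
  {x | ∀ i, v.repr (x - x₀) i ∈ Set.Ioo (0 : ℝ) 1}

/-- `β(·, ξ)` is periodic on `Ω` with respect to the lattice spanned by `v`. -/
def IsCellPeriodicOn (Ω : Set (Eu N)) (v : Module.Basis (Fin N) ℝ (Eu N))
    (β : Eu N → Eu N → Set (Eu N)) : Prop :=
  ∀ x ∈ Ω, ∀ k ∈ Submodule.span ℤ (Set.range v), x + k ∈ Ω → ∀ ξ, β (x + k) ξ = β x ξ

/-- `G` is the weak (distributional) gradient of `φ` on `ℝ^N`. -/
structure HasWeakGradient (φ : Eu N → ℝ) (G : Eu N → Eu N) : Prop where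
  locallyIntegrable : LocallyIntegrable φ volume
  locallyIntegrable_grad : LocallyIntegrable G volume
  integral_eq : ∀ θ : Eu N → ℝ, ContDiff ℝ ∞ θ → HasCompactSupport θ → ∀ w : Eu N,
    ∫ x, φ x * fderiv ℝ θ x w = -∫ x, inner ℝ (G x) w * θ x

/-- `φ` belongs to `W^{1,p}_#(Q)`, `Q = cell x₀ v`, and `∇φ = G`. Elements of this space are
represented by their periodic extensions to `ℝ^N`. -/
structure IsPeriodicSobolev (x₀ : Eu N) (v : Module.Basis (Fin N) ℝ (Eu N)) (p : ℝ)
    (φ : Eu N → ℝ) (G : Eu N → Eu N) : Prop where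
  periodic : ∀ x i, φ (x + v i) = φ x
  weakGradient : HasWeakGradient φ G
  memLp : MemLp φ (ENNReal.ofReal p) (volume.restrict (cell x₀ v))
  memLp_grad : MemLp G (ENNReal.ofReal p) (volume.restrict (cell x₀ v))
  integral_eq_zero : ∫ x in cell x₀ v, φ x = 0

/-- `g` belongs to `L^q_#(Q; ℝ^N)`, `Q = cell x₀ v`: it is in `L^q` and orthogonal to the gradients
of all elements of `W^{1,p}_#(Q)`. -/
structure IsPeriodicDivFree (x₀ : Eu N) (v : Module.Basis (Fin N) ℝ (Eu N)) (p q : ℝ)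
    (g : Eu N → Eu N) : Prop where
  memLp : MemLp g (ENNReal.ofReal q) (volume.restrict (cell x₀ v))
  orthogonal : ∀ (φ : Eu N → ℝ) (G : Eu N → Eu N), IsPeriodicSobolev x₀ v p φ G →
    ∫ x in cell x₀ v, inner ℝ (g x) (G x) = 0

/-! ### Homogenized operator and homogenized Lagrangian -/

/-- The homogenized operator: `betaHom ξ` is the set of the averages over `Q` of the
`g ∈ L^q_#(Q; ℝ^N)` with `g(y) ∈ β(y, ξ + ∇ψ(y))` a.e. in `Q` for some `ψ ∈ W^{1,p}_#(Q)`. -/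
def betaHom (x₀ : Eu N) (v : Module.Basis (Fin N) ℝ (Eu N)) (p q : ℝ)
    (β : Eu N → Eu N → Set (Eu N)) (ξ : Eu N) : Set (Eu N) :=
  {η | ∃ (g : Eu N → Eu N) (ψ : Eu N → ℝ) (G : Eu N → Eu N),
    IsPeriodicDivFree x₀ v p q g ∧ IsPeriodicSobolev x₀ v p ψ G ∧
    (∀ᵐ y ∂(volume.restrict (cell x₀ v)), g y ∈ β y (ξ + G y)) ∧
    η = ⨍ y in cell x₀ v, g y}

/-- The cell averages of `L(x, ξ + ∇φ(x), η + g(x))` over the admissible competitors: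
`φ ∈ W^{1,p}_#(Q)`, and `g ∈ L^q_#(Q; ℝ^N)` with mean zero. -/
def cellEnergies (x₀ : Eu N) (v : Module.Basis (Fin N) ℝ (Eu N)) (p q : ℝ)
    (L : Eu N → Eu N → Eu N → ℝ) (ξ η : Eu N) : Set ℝ :=
  {r | ∃ (φ : Eu N → ℝ) (G : Eu N → Eu N) (g : Eu N → Eu N),
    IsPeriodicSobolev x₀ v p φ G ∧ IsPeriodicDivFree x₀ v p q g ∧
    ∫ x in cell x₀ v, g x = 0 ∧
    r = ⨍ x in cell x₀ v, L x (ξ + G x) (η + g x)}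

/-- The homogenized Lagrangian. -/
def LHom (x₀ : Eu N) (v : Module.Basis (Fin N) ℝ (Eu N)) (p q : ℝ)
    (L : Eu N → Eu N → Eu N → ℝ) (ξ η : Eu N) : ℝ :=
  sInf (cellEnergies x₀ v p q L ξ η)

end PeriodicHom

end

/-! The integral functional F(u, w) = ∫_Q L(x, u, w) on L^p × L^q inherits selfduality from the
integrand: F*(w, u) = F(u, w). The cell problem restricts F to fields u = ξ + ∇φ and w = η + g, and
the pairing ∫⟨u, w⟩ of two such fields depends only on their means, because L^q_# annihilates
gradients and gradients of periodic functions have mean zero.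

Weak duality is therefore the pointwise Fenchel-Young inequality, integrated (`weak_duality_cell`).
Strong duality is Hahn-Banach: a form ⟨b, mean of u⟩ + ⟨a, mean of w⟩ lying below F + m on the
admissible pairs extends to a continuous form below F + m on all of L^p × L^q. By Riesz
(`exists_lp_dual`) the extension is a pair (B, A), and selfduality of F gives F(A, B) ≤ m
(`IsSelfdualIntegrand.exists_dual_pair`). Agreement with the original form on admissible pairs
forces B - b to lie in L^q_# with mean zero and A - a to be orthogonal to L^q_#, hence to be a
periodic gradient (`exists_isPeriodicSobolev_of_orthogonal`). So (A, B) is itself a competitor for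
the cell problem at (a, b), with energy at most m (`exists_cell_pair_le`).

Taking for m the value of the dual problem gives at once that the minimum is attained, that there is
no duality gap, and that L_hom is its own conjugate (`isSelfdualLagrangian_sInf_of_duality`).
Minimizers come from Hahn-Banach; no weak compactness is involved. The formula for β_hom is the
equality case: L ≥ ⟨·, ·⟩ pointwise, so equality of the averages is equality almost everywhere
(`betaHom_eq_selfdualField`).

Recognizing gradients by orthogonality requires the space of gradients to be closed in L^p. This
follows from a Poincaré inequality, itself derived from the fundamental theorem of calculus for weak
gradients and periodicity. -/

noncomputable section

namespace PeriodicHom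

open scoped ENNReal Topology
open Filter

/-! ### The dual of `L^p` -/

section LpDual

variable {α : Type*} [MeasurableSpace α] {μ : Measure α} [IsFiniteMeasure μ]

/-- A continuous functional on `L^p` is determined by its values on indicator functions. -/
lemma lp_clm_ext_of_indicator {P : ENNReal} [Fact (1 ≤ P)] (hP : P ≠ ⊤)
    {F G : Lp ℝ P μ →L[ℝ] ℝ}
    (h : ∀ (s : Set α) (hs : MeasurableSet s),
      F (indicatorConstLp P hs (measure_ne_top μ s) 1) =
        G (indicatorConstLp P hs (measure_ne_top μ s) 1)) : F = G := by
  ext u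
  induction u using Lp.induction hP with
  | @indicatorConst c s hs hμs =>
    rw [Lp.simpleFunc.coe_indicatorConst]
    have : indicatorConstLp P hs hμs.ne c = c • indicatorConstLp P hs hμs.ne (1 : ℝ) := by
      apply Lp.ext
      filter_upwards [indicatorConstLp_coeFn (p := P) (hs := hs) (hμs := hμs.ne) (c := c),
        indicatorConstLp_coeFn (p := P) (hs := hs) (hμs := hμs.ne) (c := (1 : ℝ)),
        Lp.coeFn_smul c (indicatorConstLp P hs hμs.ne (1 : ℝ))] with x h1 h2 h3
      rw [h1, h3, Pi.smul_apply, h2]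
      by_cases hx : x ∈ s <;> simp [hx]
    rw [this, map_smul, map_smul, h]
  | add hf hg _ h1 h2 => rw [map_add, map_add, h1, h2]
  | isClosed => exact isClosed_eq F.continuous G.continuous

/-- The signed measure `A ↦ f(1_A)` attached to a continuous functional `f` on `L^p`. -/
def dualSignedMeasure {P : ENNReal} [Fact (1 ≤ P)] (hP : P ≠ ⊤) (f : Lp ℝ P μ →L[ℝ] ℝ) :
    SignedMeasure α := by
  classical
  exact
  { measureOf' := fun A => if hA : MeasurableSet A then
      f (indicatorConstLp P hA (measure_ne_top μ A) 1) else 0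
    empty' := by simp
    not_measurable' := fun A hA => by simp [hA]
    m_iUnion' := by
      intro A hA hd
      have hU : MeasurableSet (⋃ i, A i) := MeasurableSet.iUnion hA
      have hF : ∀ s : Finset ℕ, MeasurableSet (⋃ i ∈ s, A i) := fun s =>
        Finset.measurableSet_biUnion s fun i _ => hA i
      have hsum : ∀ s : Finset ℕ, ∑ i ∈ s, f (indicatorConstLp P (hA i) (measure_ne_top μ _) 1) =
          f (indicatorConstLp P (hF s) (measure_ne_top μ _) 1) := by
        intro s
        rw [← map_sum]
        congr 1
        apply Lp.ext
        have h1 : ∀ᵐ x ∂μ, ∀ i, indicatorConstLp P (hA i) (measure_ne_top μ _) (1 : ℝ) x =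
            (A i).indicator (fun _ => 1) x := ae_all_iff.2 fun i => indicatorConstLp_coeFn
        filter_upwards [h1, indicatorConstLp_coeFn (p := P) (hs := hF s)
          (hμs := measure_ne_top μ _) (c := (1 : ℝ)), Lp.coeFn_finsetSum (E := ℝ) s fun i =>
            indicatorConstLp P (hA i) (measure_ne_top μ _) (1 : ℝ)] with x h1 h2 h3
        rw [h2, h3]
        simp only [Finset.sum_apply, h1]
        rw [Finset.indicator_biUnion_apply]
        intro i _ j _ hij
        exact hd hij
      simp only [HasSum, hA, hU, dite_true, hsum]
      -- Countable additivity: what the partial unions leave out decreases to ∅, so its measure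
      -- tends to 0 and, P being finite, the indicators converge in `L^P`.
      refine (f.continuous.tendsto _).comp ?_
      refine tendsto_indicatorConstLp_set hP ?_
      have hanti : Antitone fun s : Finset ℕ => (⋃ i, A i) \ ⋃ i ∈ s, A i := by
        intro s t hst
        exact Set.sdiff_subset_sdiff_right (Set.biUnion_subset_biUnion_left hst)
      have := tendsto_measure_iInter_atTop (μ := μ)
        (fun s : Finset ℕ => (hU.diff (hF s)).nullMeasurableSet) hanti
        ⟨∅, measure_ne_top μ _⟩
      have he : (⋂ s : Finset ℕ, (⋃ i, A i) \ ⋃ i ∈ s, A i) = ∅ := by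
        ext x
        simp only [Set.mem_iInter, Set.mem_sdiff, Set.mem_iUnion, Set.mem_empty_iff_false, iff_false]
        intro h
        obtain ⟨i, hi⟩ := (h ∅).1
        exact (h {i}).2 ⟨i, by simp, hi⟩
      rw [he, measure_empty] at this
      refine this.congr fun s => ?_
      change μ _ = μ _
      congr 1
      rw [symmDiff_of_le]
      exact Set.iUnion₂_subset fun i _ => Set.subset_iUnion A i }

lemma dualSignedMeasure_apply {P : ENNReal} [Fact (1 ≤ P)] (hP : P ≠ ⊤) (f : Lp ℝ P μ →L[ℝ] ℝ)
    {A : Set α} (hA : MeasurableSet A) :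
    dualSignedMeasure hP f A = f (indicatorConstLp P hA (measure_ne_top μ A) 1) := by
  classical
  change (if hA : MeasurableSet A then
      f (indicatorConstLp P hA (measure_ne_top μ A) 1) else 0) = _
  rw [dif_pos hA]

/-- Values of a functional on indicator functions are integrals of an integrable density. -/
lemma exists_density_of_lp_clm {P : ENNReal} [Fact (1 ≤ P)] (hP : P ≠ ⊤) (f : Lp ℝ P μ →L[ℝ] ℝ) :
    ∃ g : α → ℝ, Measurable g ∧ Integrable g μ ∧ ∀ (A : Set α) (hA : MeasurableSet A),
      f (indicatorConstLp P hA (measure_ne_top μ A) 1) = ∫ x in A, g x ∂μ := by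
  set s := dualSignedMeasure hP f
  have hac : s ≪ᵥ μ.toENNRealVectorMeasure := by
    refine VectorMeasure.AbsolutelyContinuous.mk fun A hA h0 => ?_
    rw [Measure.toENNRealVectorMeasure_apply_measurable hA] at h0
    rw [dualSignedMeasure_apply hP f hA]
    have : indicatorConstLp P hA (measure_ne_top μ A) (1 : ℝ) = 0 := by
      apply Lp.ext
      filter_upwards [indicatorConstLp_coeFn (p := P) (hs := hA) (hμs := measure_ne_top μ A)
        (c := (1 : ℝ)), Lp.coeFn_zero ℝ P μ, measure_eq_zero_iff_ae_notMem.1 h0] with x h1 h2 h3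
      rw [h1, h2]; simp [h3]
    rw [this, map_zero]
  refine ⟨s.rnDeriv μ, SignedMeasure.measurable_rnDeriv _ _, SignedMeasure.integrable_rnDeriv _ _,
    fun A hA => ?_⟩
  rw [← dualSignedMeasure_apply hP f hA, ← withDensityᵥ_apply (SignedMeasure.integrable_rnDeriv _ _) hA,
    SignedMeasure.withDensityᵥ_rnDeriv_eq s μ hac]

/-- The pairing of `g ∈ L^q` with the indicator function of `A` is `∫_A g`. -/
lemma lpPairing_mul_indicator {P Q : ENNReal} [Fact (1 ≤ P)] [Fact (1 ≤ Q)]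
    [ENNReal.HolderConjugate Q P] {g : α → ℝ} (hg : MemLp g Q μ) {A : Set α}
    (hA : MeasurableSet A) :
    (ContinuousLinearMap.mul ℝ ℝ).lpPairing μ Q P (hg.toLp g)
      (indicatorConstLp P hA (measure_ne_top μ A) 1) = ∫ x in A, g x ∂μ := by
  rw [ContinuousLinearMap.lpPairing_eq_integral, ← integral_indicator hA]
  apply integral_congr_ae
  filter_upwards [hg.coeFn_toLp, indicatorConstLp_coeFn (p := P) (hs := hA)
    (hμs := measure_ne_top μ A) (c := (1 : ℝ))] with x h1 h2
  rw [h1, h2]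
  by_cases hx : x ∈ A <;> simp [hx]

/-- If the pairing with a bounded function `h` is dominated by `C ‖u‖_p`, then `‖h‖_q ≤ C`. -/
lemma eLpNorm_le_of_pairing_le {p q : ℝ} (hpq : p.HolderConjugate q) {h : α → ℝ}
    (hm : Measurable h) {K : ℝ} (hb : ∀ x, |h x| ≤ K) {C : ℝ} (hC : 0 ≤ C)
    (hle : ∀ u : α → ℝ, MemLp u (ENNReal.ofReal p) μ →
      ∫ x, h x * u x ∂μ ≤ C * (eLpNorm u (ENNReal.ofReal p) μ).toReal) :
    eLpNorm h (ENNReal.ofReal q) μ ≤ ENNReal.ofReal C := by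
  have hp0 := hpq.pos
  have hq0 := hpq.symm.pos
  -- The extremal function in Hölder's inequality: |u|^p = h u = |h|^q, so the hypothesis becomes I
  -- ≤ C I^(1/p) with I = ∫ |h|^q, that is, I^(1/q) ≤ C.
  set u : α → ℝ := fun x => SignType.sign (h x) * |h x| ^ (q - 1) with hu
  have hum : Measurable u := by
    have : Measurable fun x => (SignType.sign (h x) : ℝ) := by
      have : Measurable (fun t : ℝ => (SignType.sign t : ℝ)) := by
        have h2 : (fun t : ℝ => (SignType.sign t : ℝ)) =
            fun t => if 0 < t then 1 else if t < 0 then -1 else 0 := by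
          ext t
          rcases lt_trichotomy t 0 with ht | ht | ht
          · simp [ht, ht.not_gt]
          · simp [ht]
          · simp [ht]
        rw [h2]
        exact Measurable.ite measurableSet_Ioi measurable_const
          (Measurable.ite measurableSet_Iio measurable_const measurable_const)
      exact this.comp hm
    exact this.mul ((hm.abs).pow_const _)
  have habs : ∀ x, |u x| = |h x| ^ (q - 1) := by
    intro x
    have hq1 : q - 1 ≠ 0 := (sub_pos.2 hpq.symm.lt).ne'
    rcases eq_or_ne (h x) 0 with h0 | h0
    · simp [hu, h0, Real.zero_rpow hq1]
    · have : |(SignType.sign (h x) : ℝ)| = 1 := by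
        rcases lt_or_gt_of_ne h0 with h1 | h1 <;> simp [h1]
      rw [hu]
      simp only [abs_mul, this, one_mul]
      exact abs_of_nonneg (by positivity)
  have hprod : ∀ x, h x * u x = |h x| ^ q := by
    intro x
    have : h x * (SignType.sign (h x) : ℝ) = |h x| := self_mul_sign (h x)
    rw [hu]
    simp only
    rw [← mul_assoc, this]
    rcases eq_or_ne (h x) 0 with h0 | h0
    · simp [h0, Real.zero_rpow hq0.ne']
    · nth_rw 1 [← Real.rpow_one |h x|]
      rw [← Real.rpow_add (abs_pos.2 h0)]
      ring_nf
  have hpow : ∀ x, |u x| ^ p = |h x| ^ q := by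
    intro x
    rw [habs, ← Real.rpow_mul (abs_nonneg _)]
    congr 1
    rw [hpq.symm.sub_one_mul_conj]
  have hhL : MemLp h (ENNReal.ofReal q) μ :=
    MemLp.of_bound hm.aestronglyMeasurable K (ae_of_all _ hb)
  have huL : MemLp u (ENNReal.ofReal p) μ := by
    refine MemLp.of_bound hum.aestronglyMeasurable (K ^ (q - 1)) (ae_of_all _ fun x => ?_)
    rw [Real.norm_eq_abs, habs]
    exact Real.rpow_le_rpow (abs_nonneg _) (hb x) (sub_pos.2 hpq.symm.lt).le
  have h1 := hle u huL
  rw [huL.eLpNorm_eq_integral_rpow_norm (by simpa using hp0) (by simp)] at h1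
  rw [hhL.eLpNorm_eq_integral_rpow_norm (by simpa using hq0) (by simp)]
  simp only [ENNReal.toReal_ofReal hp0.le, ENNReal.toReal_ofReal hq0.le, Real.norm_eq_abs, hpow,
    hprod] at h1 ⊢
  set I := ∫ x, |h x| ^ q ∂μ with hI
  have hI0 : 0 ≤ I := integral_nonneg fun x => by positivity
  rw [ENNReal.toReal_ofReal (by positivity)] at h1
  apply ENNReal.ofReal_le_ofReal
  rcases hI0.eq_or_lt with h0 | h0
  · rw [← h0, Real.zero_rpow (by positivity)]; exact hC
  · have h2 : I ^ q⁻¹ * I ^ p⁻¹ ≤ C * I ^ p⁻¹ := by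
      rw [← Real.rpow_add h0, add_comm, hpq.inv_add_inv_eq_one, Real.rpow_one]
      exact h1
    exact le_of_mul_le_mul_right h2 (by positivity)

/-- Riesz representation of the dual of `L^p`, real valued functions, finite measure. -/
theorem exists_lp_dual_real {p q : ℝ} (hpq : p.HolderConjugate q)
    [Fact (1 ≤ ENNReal.ofReal p)] (f : Lp ℝ (ENNReal.ofReal p) μ →L[ℝ] ℝ) :
    ∃ g : α → ℝ, MemLp g (ENNReal.ofReal q) μ ∧
      ∀ u : Lp ℝ (ENNReal.ofReal p) μ, f u = ∫ x, g x * u x ∂μ := by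
  have hP : ENNReal.ofReal p ≠ ⊤ := by simp
  have : Fact (1 ≤ ENNReal.ofReal q) := ⟨by simpa using hpq.symm.lt.le⟩
  have : ENNReal.HolderConjugate (ENNReal.ofReal q) (ENNReal.ofReal p) := hpq.symm.ennrealOfReal
  obtain ⟨g, hgm, hgi, hg⟩ := exists_density_of_lp_clm hP f
  -- The density is so far only integrable. Its truncations are bounded, hence in L^q; a bound on
  -- their norms uniform in `k` passes to the limit.
  set S : ℕ → Set α := fun k => {x | |g x| ≤ k} with hS
  have hSm : ∀ k, MeasurableSet (S k) := fun k => measurableSet_le hgm.abs measurable_const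
  set h : ℕ → α → ℝ := fun k => (S k).indicator g with hh
  have hhm : ∀ k, Measurable (h k) := fun k => hgm.indicator (hSm k)
  have hhb : ∀ k x, |h k x| ≤ k := by
    intro k x
    by_cases hx : x ∈ S k
    · simp only [hh, Set.indicator_of_mem hx]; exact hx
    · simp [hh, hx]
  have hhL : ∀ k, MemLp (h k) (ENNReal.ofReal q) μ := fun k =>
    MemLp.of_bound (hhm k).aestronglyMeasurable k (ae_of_all _ (hhb k))
  have hbound : ∀ k, eLpNorm (h k) (ENNReal.ofReal q) μ ≤ ENNReal.ofReal ‖f‖ := by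
    intro k
    -- Pairing with `h k` is `f` composed with multiplication by the indicator of `S k`, which does
    -- not increase the L^p norm. Hence the bound ‖f‖ for every `k`.
    set c : Lp ℝ ⊤ μ := indicatorConstLp ⊤ (hSm k) (measure_ne_top μ _) 1 with hc
    have hcc : ∀ᵐ x ∂μ, c x = (S k).indicator (fun _ => 1) x := indicatorConstLp_coeFn
    set m : Lp ℝ (ENNReal.ofReal p) μ →L[ℝ] Lp ℝ (ENNReal.ofReal p) μ :=
      (ContinuousLinearMap.mul ℝ ℝ).holderL μ ⊤ (ENNReal.ofReal p) (ENNReal.ofReal p) c with hm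
    have hmc : ∀ u : Lp ℝ (ENNReal.ofReal p) μ, m u =ᵐ[μ] fun x => c x * u x := by
      intro u
      exact (ContinuousLinearMap.mul ℝ ℝ).coeFn_holder c u
    have hEq : f.comp m =
        (ContinuousLinearMap.mul ℝ ℝ).lpPairing μ _ (ENNReal.ofReal p) ((hhL k).toLp (h k)) := by
      apply lp_clm_ext_of_indicator hP
      intro A hA
      rw [lpPairing_mul_indicator, ContinuousLinearMap.comp_apply]
      have : m (indicatorConstLp _ hA (measure_ne_top μ A) 1) =
          indicatorConstLp _ ((hSm k).inter hA) (measure_ne_top μ _) 1 := by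
        apply Lp.ext
        filter_upwards [hmc (indicatorConstLp _ hA (measure_ne_top μ A) 1), hcc,
          indicatorConstLp_coeFn (p := ENNReal.ofReal p) (hs := hA) (hμs := measure_ne_top μ A)
            (c := (1 : ℝ)),
          indicatorConstLp_coeFn (p := ENNReal.ofReal p) (hs := (hSm k).inter hA)
            (hμs := measure_ne_top μ _) (c := (1 : ℝ))] with x h1 h2 h3 h4
        rw [h1, h2, h3, h4]
        by_cases hx : x ∈ S k <;> by_cases hx' : x ∈ A <;> simp [hx, hx']
      rw [this, hg, hh, ← integral_indicator ((hSm k).inter hA), ← integral_indicator hA,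
        Set.inter_comm, Set.indicator_indicator]
    refine eLpNorm_le_of_pairing_le hpq (hhm k) (hhb k) (norm_nonneg f) fun u hu => ?_
    have h1 : ∫ x, h k x * u x ∂μ = f (m (hu.toLp u)) := by
      rw [← ContinuousLinearMap.comp_apply, hEq, ContinuousLinearMap.lpPairing_eq_integral]
      apply integral_congr_ae
      filter_upwards [(hhL k).coeFn_toLp, hu.coeFn_toLp] with x h1 h2
      rw [h1, h2]; rfl
    rw [h1]
    have h2 : ‖m (hu.toLp u)‖ ≤ (eLpNorm u (ENNReal.ofReal p) μ).toReal := by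
      rw [Lp.norm_def]
      refine ENNReal.toReal_mono hu.2.ne ?_
      refine eLpNorm_mono_ae ?_
      filter_upwards [hmc (hu.toLp u), hcc, hu.coeFn_toLp] with x h1 h2 h3
      rw [h1, h2, h3]
      by_cases hx : x ∈ S k <;> simp [hx]
    calc f (m (hu.toLp u)) ≤ ‖f (m (hu.toLp u))‖ := le_abs_self _
      _ ≤ ‖f‖ * ‖m (hu.toLp u)‖ := f.le_opNorm _
      _ ≤ _ := by gcongr
  have hgL : MemLp g (ENNReal.ofReal q) μ := by
    refine ⟨hgm.aestronglyMeasurable, ?_⟩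
    have hlim : ∀ᵐ x ∂μ, Tendsto (fun k => h k x) atTop (𝓝 (g x)) := by
      refine ae_of_all _ fun x => ?_
      refine tendsto_const_nhds.congr' ?_
      filter_upwards [eventually_ge_atTop ⌈|g x|⌉₊] with k hk
      have : x ∈ S k := Nat.ceil_le.1 hk
      simp [hh, this]
    -- Fatou's lemma along the truncations.
    refine (Lp.eLpNorm_lim_le_liminf_eLpNorm (fun k => (hhm k).aestronglyMeasurable) g hlim).trans_lt
      ?_
    refine lt_of_le_of_lt ?_ (ENNReal.ofReal_lt_top (r := ‖f‖))
    calc liminf (fun k => eLpNorm (h k) (ENNReal.ofReal q) μ) atTop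
        ≤ liminf (fun _ : ℕ => ENNReal.ofReal ‖f‖) atTop := liminf_le_liminf (.of_forall hbound)
      _ = ENNReal.ofReal ‖f‖ := liminf_const _
  refine ⟨g, hgL, fun u => ?_⟩
  have hEq : f = (ContinuousLinearMap.mul ℝ ℝ).lpPairing μ _ (ENNReal.ofReal p) (hgL.toLp g) := by
    apply lp_clm_ext_of_indicator hP
    intro A hA
    rw [lpPairing_mul_indicator, hg]
  rw [hEq, ContinuousLinearMap.lpPairing_eq_integral]
  apply integral_congr_ae
  filter_upwards [hgL.coeFn_toLp] with x h1
  rw [h1]; rfl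

/-- Riesz representation of the dual of `L^p`, functions with values in `ℝ^N`, finite measure. -/
theorem exists_lp_dual {N : ℕ} {p q : ℝ} (hpq : p.HolderConjugate q)
    [Fact (1 ≤ ENNReal.ofReal p)] (f : Lp (Eu N) (ENNReal.ofReal p) μ →L[ℝ] ℝ) :
    ∃ g : α → Eu N, MemLp g (ENNReal.ofReal q) μ ∧
      ∀ u : Lp (Eu N) (ENNReal.ofReal p) μ, f u = ∫ x, inner ℝ (g x) (u x) ∂μ := by
  have : Fact (1 ≤ ENNReal.ofReal q) := ⟨by simpa using hpq.symm.lt.le⟩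
  have : ENNReal.HolderConjugate (ENNReal.ofReal q) (ENNReal.ofReal p) := hpq.symm.ennrealOfReal
  set e : Fin N → Eu N := fun i => EuclideanSpace.single i 1 with he
  set J : Fin N → ℝ →L[ℝ] Eu N := fun i => ContinuousLinearMap.toSpanSingleton ℝ (e i) with hJ
  set π : Fin N → Eu N →L[ℝ] ℝ := fun i => EuclideanSpace.proj i with hπ
  choose g hgL hg using fun i => exists_lp_dual_real hpq
    (f.comp ((J i).compLpL (ENNReal.ofReal p) μ))
  refine ⟨fun x => ∑ i, g i x • e i, ?_, fun u => ?_⟩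
  · refine memLp_finsetSum _ fun i _ => ?_
    exact (J i).comp_memLp' (hgL i)
  · have hu : u = ∑ i, (J i).compLpL (ENNReal.ofReal p) μ ((π i).compLpL (ENNReal.ofReal p) μ u) := by
      apply Lp.ext
      have h1 : ∀ᵐ x ∂μ, ∀ i, (J i).compLpL (ENNReal.ofReal p) μ
          ((π i).compLpL (ENNReal.ofReal p) μ u) x =
          J i ((π i).compLpL (ENNReal.ofReal p) μ u x) :=
        ae_all_iff.2 fun i => ContinuousLinearMap.coeFn_compLpL _ _
      have h2 : ∀ᵐ x ∂μ, ∀ i, (π i).compLpL (ENNReal.ofReal p) μ u x = π i (u x) :=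
        ae_all_iff.2 fun i => ContinuousLinearMap.coeFn_compLpL _ _
      filter_upwards [h1, h2, Lp.coeFn_finsetSum (E := Eu N) Finset.univ fun i =>
        (J i).compLpL (ENNReal.ofReal p) μ ((π i).compLpL (ENNReal.ofReal p) μ u)] with x h1 h2 h3
      rw [h3]
      simp only [Finset.sum_apply, h1, h2]
      ext j
      simp [hJ, hπ, he, Finset.sum_apply, Pi.single_apply]
    have hint : ∀ i, Integrable (fun x => g i x * π i (u x)) μ := fun i =>
      MemLp.integrable_mul (hgL i) ((π i).comp_memLp' (Lp.memLp u))
    conv_lhs => rw [hu, map_sum]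
    have : ∀ x, inner ℝ (∑ i, g i x • e i) (u x) = ∑ i, g i x * π i (u x) := by
      intro x
      rw [sum_inner]
      refine Finset.sum_congr rfl fun i _ => ?_
      rw [inner_smul_left]
      simp [he, hπ, EuclideanSpace.inner_single_left]
    simp only [this]
    rw [integral_finsetSum _ fun i _ => hint i]
    refine Finset.sum_congr rfl fun i _ => ?_
    rw [← ContinuousLinearMap.comp_apply, hg i]
    apply integral_congr_ae
    filter_upwards [ContinuousLinearMap.coeFn_compLpL (p := ENNReal.ofReal p) (μ := μ) (π i) u] with x h1
    rw [h1]

end LpDual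

/-! ### Selfdual Lagrangians -/

section Pointwise

variable {N : ℕ} {ℓ : Eu N → Eu N → ℝ}

/-- The Fenchel-Young inequality, with the conjugate replaced by the Lagrangian itself through
selfduality. -/
lemma IsSelfdualLagrangian.inner_add_inner_le (h : IsSelfdualLagrangian ℓ) (a b a' b' : Eu N) :
    inner ℝ b a' + inner ℝ a b' ≤ ℓ a b + ℓ a' b' := by
  have h1 : ((inner ℝ b a' + inner ℝ a b' - ℓ a' b' : ℝ) : EReal) ≤ fenchelDual ℓ b a :=
    le_iSup (fun z : Eu N × Eu N =>
      ((inner ℝ b z.1 + inner ℝ a z.2 - ℓ z.1 z.2 : ℝ) : EReal)) (a', b')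
  rw [h.dual_eq, EReal.coe_le_coe_iff] at h1
  linarith

lemma IsSelfdualLagrangian.inner_le (h : IsSelfdualLagrangian ℓ) (a b : Eu N) :
    inner ℝ a b ≤ ℓ a b := by
  have := h.inner_add_inner_le a b a b
  rw [real_inner_comm] at this
  linarith

/-- A finite convex function on a finite-dimensional space is locally Lipschitz. -/
lemma IsSelfdualLagrangian.continuous (h : IsSelfdualLagrangian ℓ) :
    Continuous fun z : Eu N × Eu N => ℓ z.1 z.2 :=
  h.convex.locallyLipschitz.continuous

/-- Almost optimal pairs in the definition of the dual can be picked from a dense sequence. -/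
lemma IsSelfdualLagrangian.exists_denseSeq (h : IsSelfdualLagrangian ℓ) (a b : Eu N) {ε : ℝ}
    (hε : 0 < ε) : ∃ n : ℕ, ℓ a b - ε ≤
      inner ℝ b (TopologicalSpace.denseSeq (Eu N × Eu N) n).1 +
      inner ℝ a (TopologicalSpace.denseSeq (Eu N × Eu N) n).2 -
      ℓ (TopologicalSpace.denseSeq (Eu N × Eu N) n).1
        (TopologicalSpace.denseSeq (Eu N × Eu N) n).2 := by
  have h1 : ((ℓ a b - ε : ℝ) : EReal) < fenchelDual ℓ b a := by
    rw [h.dual_eq, EReal.coe_lt_coe_iff]; linarith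
  obtain ⟨z, hz⟩ := lt_iSup_iff.1 h1
  rw [EReal.coe_lt_coe_iff] at hz
  have hc : Continuous fun z : Eu N × Eu N =>
      inner ℝ b z.1 + inner ℝ a z.2 - ℓ z.1 z.2 := by
    have := h.continuous
    fun_prop
  have ho : IsOpen {z : Eu N × Eu N | ℓ a b - ε < inner ℝ b z.1 + inner ℝ a z.2 - ℓ z.1 z.2} :=
    isOpen_lt continuous_const hc
  obtain ⟨n, hn⟩ := (TopologicalSpace.denseRange_denseSeq (Eu N × Eu N)).exists_mem_open ho ⟨z, hz⟩
  exact ⟨n, le_of_lt hn⟩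

end Pointwise

/-- Young's inequality for the rescaled product (s a)(s⁻¹ b), with s chosen so that s^p / p = c. -/
lemma exists_young_const {p q : ℝ} (hpq : p.HolderConjugate q) {c : ℝ} (hc : 0 < c) :
    ∃ K : ℝ, 0 ≤ K ∧ ∀ a b : ℝ, 0 ≤ a → 0 ≤ b → b * a ≤ c * a ^ p + K * b ^ q := by
  have hp := hpq.pos
  have hq := hpq.symm.pos
  set s : ℝ := (c * p) ^ p⁻¹ with hs
  have hs0 : 0 < s := by positivity
  refine ⟨(s⁻¹) ^ q / q, by positivity, fun a b ha hb => ?_⟩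
  have h1 := Real.young_inequality_of_nonneg (mul_nonneg hs0.le ha)
    (mul_nonneg (inv_nonneg.2 hs0.le) hb) hpq
  have h2 : s * a * (s⁻¹ * b) = b * a := by field_simp
  have h3 : s ^ p = c * p := by
    rw [hs, ← Real.rpow_mul (by positivity), inv_mul_cancel₀ hp.ne', Real.rpow_one]
  rw [h2, Real.mul_rpow hs0.le ha, Real.mul_rpow (by positivity) hb, h3] at h1
  refine h1.trans (le_of_eq ?_)
  field_simp

/-- Sandwich form of the Hahn-Banach theorem: a continuous linear form which is dominated on a
subspace by a continuous convex function agrees on the subspace with one dominated everywhere. -/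
lemma exists_dominated_of_convex {E : Type*} [NormedAddCommGroup E] [NormedSpace ℝ E]
    {F : E → ℝ} (hF : ConvexOn ℝ Set.univ F) (hFc : Continuous F) (S : Submodule ℝ E)
    (l : E →L[ℝ] ℝ) (h : ∀ z ∈ S, l z ≤ F z) :
    ∃ Λ : E →L[ℝ] ℝ, (∀ z ∈ S, Λ z = l z) ∧ ∀ z, Λ z ≤ F z := by
  -- The strict epigraph of `F` is open and convex, and it misses the graph `T` of `l` over `S`
  -- because `l ≤ F` there. The separating hyperplane is the graph of the extension.
  set s : Set (E × ℝ) := {z | z.1 ∈ Set.univ ∧ F z.1 < z.2}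
  have hs : Convex ℝ s := hF.convex_strict_epigraph
  have hso : IsOpen s := by
    have : s = {z : E × ℝ | F z.1 < z.2} := by ext; simp [s]
    rw [this]
    exact isOpen_lt (hFc.comp continuous_fst) continuous_snd
  set T : Submodule ℝ (E × ℝ) := S.map ((LinearMap.id : E →ₗ[ℝ] E).prod l.toLinearMap) with hT
  have hd : Disjoint s (T : Set (E × ℝ)) := by
    rw [Set.disjoint_left]
    rintro z hz hzT
    obtain ⟨y, hy, rfl⟩ := hzT
    exact absurd (h y hy) (not_le.2 hz.2)
  obtain ⟨f, u, hfs, hft⟩ := geometric_hahn_banach_open hs hso T.convex hd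
  have hu : u ≤ 0 := by simpa using hft 0 T.zero_mem
  -- A linear form bounded below on a subspace vanishes on it.
  have hf0 : ∀ y ∈ T, f y = 0 := by
    intro y hy
    by_contra hne
    have h1 := hft (((u - 1) / f y) • y) (T.smul_mem _ hy)
    rw [map_smul, smul_eq_mul, div_mul_cancel₀ _ hne] at h1
    linarith
  set c : ℝ := f (0, 1) with hc
  have hfd : ∀ x r, f (x, r) = f (x, 0) + r * c := by
    intro x r
    have : ((x, r) : E × ℝ) = (x, 0) + r • (0, 1) := by simp
    rw [this, map_add, map_smul, smul_eq_mul]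
  have hneg : ∀ x r, F x < r → f (x, 0) + r * c < 0 := by
    intro x r hr
    rw [← hfd]
    exact (hfs (x, r) ⟨trivial, hr⟩).trans_le hu
  -- The hyperplane is not vertical: since `F` is finite at 0, the points (0, r) with r large and
  -- positive lie in the epigraph, and there `f` equals r c, which is negative.
  have hc0 : c < 0 := by
    have h1 := hneg 0 (max (F 0) 0 + 1) (by linarith [le_max_left (F 0) 0])
    rw [show ((0 : E), (0 : ℝ)) = 0 from rfl, map_zero, zero_add] at h1
    have : 0 < max (F 0) 0 + 1 := by linarith [le_max_right (F 0) 0]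
    by_contra hcc
    push Not at hcc
    nlinarith
  refine ⟨(-c⁻¹) • f.comp (ContinuousLinearMap.inl ℝ E ℝ), fun z hz => ?_, fun z => ?_⟩
  · have h1 := hf0 (z, l z) ⟨z, hz, rfl⟩
    rw [hfd] at h1
    simp only [smul_apply, ContinuousLinearMap.comp_apply,
      ContinuousLinearMap.inl_apply, smul_eq_mul]
    have : f (z, 0) = -(l z * c) := by linarith
    rw [this, neg_mul_neg, mul_comm (l z), inv_mul_cancel_left₀ hc0.ne]
  · simp only [smul_apply, ContinuousLinearMap.comp_apply,
      ContinuousLinearMap.inl_apply, smul_eq_mul]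
    refine le_of_forall_gt fun r hr => ?_
    have h1 := hneg z r hr
    have h2 : f (z, 0) < r * (-c) := by linarith
    have h3 : (-c⁻¹) * f (z, 0) < (-c⁻¹) * (r * (-c)) :=
      mul_lt_mul_of_pos_left h2 (by rw [neg_pos]; exact inv_lt_zero.2 hc0)
    have h4 : (-c⁻¹) * (r * (-c)) = r := by
      rw [mul_neg r, neg_mul_neg, mul_comm r, inv_mul_cancel_left₀ hc0.ne]
    linarith

/-- Normal integrands that are selfdual Lagrangians with `p`-`q` growth. -/
structure IsSelfdualIntegrand {α : Type*} [MeasurableSpace α] (μ : Measure α) {N : ℕ} (p q : ℝ)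
    (ℓ : α → Eu N → Eu N → ℝ) : Prop where
  aestronglyMeasurable : ∀ u w : α → Eu N, AEStronglyMeasurable u μ → AEStronglyMeasurable w μ →
    AEStronglyMeasurable (fun x => ℓ x (u x) (w x)) μ
  selfdual : ∀ᵐ x ∂μ, IsSelfdualLagrangian (ℓ x)
  growth : ∃ C₀ C₁ : ℝ, 0 < C₀ ∧ 0 < C₁ ∧ ∃ n₀ n₁ : α → ℝ, Integrable n₀ μ ∧ Integrable n₁ μ ∧
    ∀ᵐ x ∂μ, ∀ a b : Eu N, C₀ * (‖a‖ ^ p + ‖b‖ ^ q - n₀ x) ≤ ℓ x a b ∧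
      ℓ x a b ≤ C₁ * (‖a‖ ^ p + ‖b‖ ^ q + n₁ x)

section Integrand

variable {α : Type*} [MeasurableSpace α] {μ : Measure α} {N : ℕ} {p q : ℝ}
  {ℓ : α → Eu N → Eu N → ℝ}

lemma memLp_ofReal_of_integrable_norm_rpow {E : Type*} [NormedAddCommGroup E] {p : ℝ} (hp : 0 < p)
    {u : α → E} (hu : AEStronglyMeasurable u μ) (hi : Integrable (fun x => ‖u x‖ ^ p) μ) :
    MemLp u (ENNReal.ofReal p) μ := by
  rw [← integrable_norm_rpow_iff hu (by simpa using hp) (by simp), ENNReal.toReal_ofReal hp.le]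
  exact hi

lemma integral_norm_rpow_eq_norm_rpow {p : ℝ} (hp : 0 < p) (u : Lp (Eu N) (ENNReal.ofReal p) μ) :
    ∫ x, ‖u x‖ ^ p ∂μ = ‖u‖ ^ p := by
  have hI : 0 ≤ ∫ x, ‖u x‖ ^ p ∂μ := integral_nonneg fun x => by positivity
  rw [Lp.norm_def, (Lp.memLp u).eLpNorm_eq_integral_rpow_norm (by simpa using hp) (by simp),
    ENNReal.toReal_ofReal hp.le, ENNReal.toReal_ofReal (by positivity), ← Real.rpow_mul hI,
    inv_mul_cancel₀ hp.ne', Real.rpow_one]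

lemma integrable_inner_of_conj (hpq : p.HolderConjugate q) {u w : α → Eu N}
    (hu : MemLp u (ENNReal.ofReal p) μ) (hw : MemLp w (ENNReal.ofReal q) μ) :
    Integrable (fun x => inner ℝ (u x) (w x)) μ := by
  have := hpq.ennrealOfReal
  exact memLp_one_iff_integrable.1
    ((innerSL ℝ (E := Eu N)).memLp_of_bilin 1 hu hw)

variable [IsFiniteMeasure μ]

lemma integrable_norm_rpow_of_memLp_ofReal {E : Type*} [NormedAddCommGroup E] {p : ℝ} (hp : 0 < p)
    {u : α → E} (hu : MemLp u (ENNReal.ofReal p) μ) : Integrable (fun x => ‖u x‖ ^ p) μ := by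
  simpa [ENNReal.toReal_ofReal hp.le] using hu.integrable_norm_rpow'

lemma IsSelfdualIntegrand.integrable (h : IsSelfdualIntegrand μ p q ℓ)
    (hpq : p.HolderConjugate q) {u w : α → Eu N} (hu : MemLp u (ENNReal.ofReal p) μ)
    (hw : MemLp w (ENNReal.ofReal q) μ) : Integrable (fun x => ℓ x (u x) (w x)) μ := by
  obtain ⟨C₀, C₁, hC₀, hC₁, n₀, n₁, hn₀, hn₁, hg⟩ := h.growth
  have hu' := integrable_norm_rpow_of_memLp_ofReal hpq.pos hu
  have hw' := integrable_norm_rpow_of_memLp_ofReal hpq.symm.pos hw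
  refine Integrable.mono' (g := fun x => C₀ * |n₀ x| + C₁ * (‖u x‖ ^ p + ‖w x‖ ^ q + |n₁ x|))
    ((hn₀.abs.const_mul _).add (((hu'.add hw').add hn₁.abs).const_mul _))
    (h.aestronglyMeasurable u w hu.1 hw.1) ?_
  filter_upwards [hg] with x hx
  obtain ⟨h1, h2⟩ := hx (u x) (w x)
  have e1 : 0 ≤ ‖u x‖ ^ p := by positivity
  have e2 : 0 ≤ ‖w x‖ ^ q := by positivity
  rw [Real.norm_eq_abs, abs_le]
  constructor
  · have : C₀ * (-|n₀ x|) ≤ C₀ * (‖u x‖ ^ p + ‖w x‖ ^ q - n₀ x) := by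
      gcongr; linarith [le_abs_self (n₀ x)]
    have : 0 ≤ C₁ * (‖u x‖ ^ p + ‖w x‖ ^ q + |n₁ x|) := by positivity
    linarith
  · have : C₁ * (‖u x‖ ^ p + ‖w x‖ ^ q + n₁ x) ≤ C₁ * (‖u x‖ ^ p + ‖w x‖ ^ q + |n₁ x|) := by
      gcongr; exact le_abs_self _
    have : 0 ≤ C₀ * |n₀ x| := by positivity
    linarith

/-- The integral functional attached to an integrand. -/
def integralFunctional (μ : Measure α) (p q : ℝ) (ℓ : α → Eu N → Eu N → ℝ)
    (z : Lp (Eu N) (ENNReal.ofReal p) μ × Lp (Eu N) (ENNReal.ofReal q) μ) : ℝ :=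
  ∫ x, ℓ x (z.1 x) (z.2 x) ∂μ

lemma IsSelfdualIntegrand.convexOn (h : IsSelfdualIntegrand μ p q ℓ)
    (hpq : p.HolderConjugate q) : ConvexOn ℝ Set.univ (integralFunctional μ p q ℓ) := by
  refine ⟨convex_univ, fun z _ z' _ a b ha hb hab => ?_⟩
  simp only [integralFunctional, smul_eq_mul]
  rw [← integral_const_mul, ← integral_const_mul, ← integral_add]
  · refine integral_mono_ae (h.integrable hpq (Lp.memLp _) (Lp.memLp _))
      (((h.integrable hpq (Lp.memLp _) (Lp.memLp _)).const_mul _).add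
        ((h.integrable hpq (Lp.memLp _) (Lp.memLp _)).const_mul _)) ?_
    filter_upwards [h.selfdual, Lp.coeFn_add (a • z.1) (b • z'.1), Lp.coeFn_add (a • z.2) (b • z'.2),
      Lp.coeFn_smul a z.1, Lp.coeFn_smul b z'.1, Lp.coeFn_smul a z.2, Lp.coeFn_smul b z'.2] with
      x hx h1 h2 h3 h4 h5 h6
    have e1 : (a • z + b • z').1 x = a • z.1 x + b • z'.1 x := by
      rw [Prod.fst_add, Prod.smul_fst, Prod.smul_fst, h1, Pi.add_apply, h3, h4]; rfl
    have e2 : (a • z + b • z').2 x = a • z.2 x + b • z'.2 x := by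
      rw [Prod.snd_add, Prod.smul_snd, Prod.smul_snd, h2, Pi.add_apply, h5, h6]; rfl
    simp only [e1, e2]
    exact hx.convex.2 (x := (z.1 x, z.2 x)) (y := (z'.1 x, z'.2 x)) trivial trivial ha hb hab
  · exact (h.integrable hpq (Lp.memLp _) (Lp.memLp _)).const_mul _
  · exact (h.integrable hpq (Lp.memLp _) (Lp.memLp _)).const_mul _

/-- A convex function on a normed space is continuous once it is bounded above near a single point;
near 0 the upper growth condition supplies a continuous majorant. -/
lemma IsSelfdualIntegrand.continuous (h : IsSelfdualIntegrand μ p q ℓ)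
    (hpq : p.HolderConjugate q) [Fact (1 ≤ ENNReal.ofReal p)] [Fact (1 ≤ ENNReal.ofReal q)] :
    Continuous (integralFunctional μ p q ℓ) := by
  obtain ⟨C₀, C₁, hC₀, hC₁, n₀, n₁, hn₀, hn₁, hg⟩ := h.growth
  rw [← continuousOn_univ]
  refine ((h.convexOn hpq).continuousOn_tfae isOpen_univ Set.univ_nonempty).out 3 1 |>.1 ?_
  refine ⟨0, trivial, ?_⟩
  have hle : ∀ z, integralFunctional μ p q ℓ z ≤
      C₁ * (‖z.1‖ ^ p + ‖z.2‖ ^ q + ∫ x, n₁ x ∂μ) := by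
    intro z
    have h1 := integrable_norm_rpow_of_memLp_ofReal hpq.pos (Lp.memLp z.1)
    have h2 := integrable_norm_rpow_of_memLp_ofReal hpq.symm.pos (Lp.memLp z.2)
    rw [← integral_norm_rpow_eq_norm_rpow hpq.pos, ← integral_norm_rpow_eq_norm_rpow hpq.symm.pos,
      ← integral_add h1 h2]
    have h3 := integral_add (h1.add h2) hn₁
    simp only [Pi.add_apply] at h3
    rw [← h3, ← integral_const_mul]
    refine integral_mono_ae (h.integrable hpq (Lp.memLp _) (Lp.memLp _))
      (((h1.add h2).add hn₁).const_mul _) ?_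
    filter_upwards [hg] with x hx using (hx _ _).2
  have hc : Continuous fun z : Lp (Eu N) (ENNReal.ofReal p) μ × Lp (Eu N) (ENNReal.ofReal q) μ =>
      C₁ * (‖z.1‖ ^ p + ‖z.2‖ ^ q + ∫ x, n₁ x ∂μ) := by
    refine continuous_const.mul (((continuous_fst.norm.rpow_const fun z => Or.inr hpq.pos.le).add
      (continuous_snd.norm.rpow_const fun z => Or.inr hpq.symm.pos.le)).add continuous_const)
  refine IsBoundedUnder.mono_le (hc.tendsto 0).isBoundedUnder_le (Eventually.of_forall hle)

/-- Measurable selection of almost optimal pairs in the definition of the dual. -/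
lemma IsSelfdualIntegrand.exists_almost_optimal (h : IsSelfdualIntegrand μ p q ℓ)
    (hpq : p.HolderConjugate q) {A B : α → Eu N} (hA : MemLp A (ENNReal.ofReal p) μ)
    (hB : MemLp B (ENNReal.ofReal q) μ) {ε : ℝ} (hε : 0 < ε) :
    ∃ u w : α → Eu N, MemLp u (ENNReal.ofReal p) μ ∧ MemLp w (ENNReal.ofReal q) μ ∧
      ∀ᵐ x ∂μ, ℓ x (A x) (B x) - ε ≤
        inner ℝ (B x) (u x) + inner ℝ (A x) (w x) - ℓ x (u x) (w x) := by
  classical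
  set d := TopologicalSpace.denseSeq (Eu N × Eu N) with hd
  set f : ℕ → α → ℝ := fun n x =>
    inner ℝ (B x) (d n).1 + inner ℝ (A x) (d n).2 - ℓ x (d n).1 (d n).2 - ℓ x (A x) (B x) with hf
  have hfm : ∀ n, AEStronglyMeasurable (f n) μ := fun n =>
    (((hB.1.inner aestronglyMeasurable_const).add (hA.1.inner aestronglyMeasurable_const)).sub
      (h.aestronglyMeasurable _ _ aestronglyMeasurable_const aestronglyMeasurable_const)).sub
      (h.aestronglyMeasurable _ _ hA.1 hB.1)
  set g : ℕ → α → ℝ := fun n => (hfm n).mk (f n) with hg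
  have hgm : ∀ n, Measurable (g n) := fun n => (hfm n).stronglyMeasurable_mk.measurable
  have hfg : ∀ᵐ x ∂μ, ∀ n, f n x = g n x := ae_all_iff.2 fun n => (hfm n).ae_eq_mk
  -- The second alternative only makes the search for the first good index total. It fails almost
  -- everywhere, since some point of the dense sequence is almost optimal.
  set P : ℕ → α → Prop := fun n x => -ε ≤ g n x ∨ ∀ m, g m x < -ε with hP
  have hPm : ∀ n, MeasurableSet {x | P n x} := fun n => by
    refine (measurableSet_le measurable_const (hgm n)).union ?_
    have : {x | ∀ m, g m x < -ε} = ⋂ m, {x | g m x < -ε} := by ext; simp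
    change MeasurableSet {x | ∀ m, g m x < -ε}
    rw [this]
    exact MeasurableSet.iInter fun m => measurableSet_lt (hgm m) measurable_const
  have hPe : ∀ x, ∃ n, P n x := by
    intro x
    by_cases hx : ∃ n, -ε ≤ g n x
    · obtain ⟨n, hn⟩ := hx
      exact ⟨n, Or.inl hn⟩
    · push Not at hx
      exact ⟨0, Or.inr hx⟩
  set z : α → Eu N × Eu N := fun x => d (Nat.find (hPe x)) with hz
  have hzm : Measurable z := by
    have : Measurable fun x => Nat.find (hPe x) := measurable_find hPe hPm
    exact (measurable_from_nat (f := d)).comp this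
  have hopt : ∀ᵐ x ∂μ, ℓ x (A x) (B x) - ε ≤
      inner ℝ (B x) (z x).1 + inner ℝ (A x) (z x).2 - ℓ x (z x).1 (z x).2 := by
    filter_upwards [hfg, h.selfdual] with x hx hsd
    obtain ⟨n, hn⟩ := hsd.exists_denseSeq (A x) (B x) hε
    have h1 : -ε ≤ g n x := by
      rw [← hx n]; simp only [hf]; linarith
    rcases Nat.find_spec (hPe x) with h2 | h2
    · rw [← hx] at h2
      simp only [hf] at h2
      simp only [hz]
      linarith
    · exact absurd (h2 n) (not_lt.2 h1)
  obtain ⟨C₀, C₁, hC₀, hC₁, n₀, n₁, hn₀, hn₁, hgr⟩ := h.growth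
  -- The pairings ⟨B, u⟩ and ⟨A, w⟩ are absorbed into half of the coercivity of ℓ(u, w). The lower
  -- bound at (u, w) and the one at (A, B) each cost C₀ |n₀|, whence the 2 C₀ |n₀| in `R`.
  obtain ⟨K, hK0, hK⟩ := exists_young_const hpq (half_pos hC₀)
  obtain ⟨K', hK0', hK'⟩ := exists_young_const hpq.symm (half_pos hC₀)
  set R : α → ℝ := fun x => (2 / C₀) * (K * ‖B x‖ ^ q + K' * ‖A x‖ ^ p + 2 * C₀ * |n₀ x| + ε) with hR
  have hRi : Integrable R μ :=
    (((((integrable_norm_rpow_of_memLp_ofReal hpq.symm.pos hB).const_mul _).add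
      ((integrable_norm_rpow_of_memLp_ofReal hpq.pos hA).const_mul _)).add
      (hn₀.abs.const_mul _)).add (integrable_const _)).const_mul _
  have hbd : ∀ᵐ x ∂μ, ‖(z x).1‖ ^ p + ‖(z x).2‖ ^ q ≤ R x := by
    filter_upwards [hopt, hgr] with x hx hgx
    have h1 := (hgx (z x).1 (z x).2).1
    have h2 := (hgx (A x) (B x)).1
    have h3 := (real_inner_le_norm (B x) (z x).1).trans (hK _ _ (norm_nonneg _) (norm_nonneg _))
    have h4 := (real_inner_le_norm (A x) (z x).2).trans (hK' _ _ (norm_nonneg _) (norm_nonneg _))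
    have e1 : 0 ≤ C₀ * ‖A x‖ ^ p := by positivity
    have e2 : 0 ≤ C₀ * ‖B x‖ ^ q := by positivity
    have e3 : C₀ * n₀ x ≤ C₀ * |n₀ x| := by gcongr; exact le_abs_self _
    have h5 : (C₀ / 2) * (‖(z x).1‖ ^ p + ‖(z x).2‖ ^ q) ≤
        K * ‖B x‖ ^ q + K' * ‖A x‖ ^ p + 2 * C₀ * |n₀ x| + ε := by linarith
    calc ‖(z x).1‖ ^ p + ‖(z x).2‖ ^ q
        = (2 / C₀) * ((C₀ / 2) * (‖(z x).1‖ ^ p + ‖(z x).2‖ ^ q)) := by field_simp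
      _ ≤ _ := by simp only [hR]; gcongr
  refine ⟨fun x => (z x).1, fun x => (z x).2, ?_, ?_, hopt⟩
  · have hm : Measurable fun x => (z x).1 := hzm.fst
    refine memLp_ofReal_of_integrable_norm_rpow hpq.pos hm.aestronglyMeasurable
      (hRi.mono' (hm.norm.pow_const p).aestronglyMeasurable ?_)
    filter_upwards [hbd] with x hx
    have : 0 ≤ ‖(z x).2‖ ^ q := by positivity
    rw [Real.norm_of_nonneg (by positivity)]
    linarith
  · have hm : Measurable fun x => (z x).2 := hzm.snd
    refine memLp_ofReal_of_integrable_norm_rpow hpq.symm.pos hm.aestronglyMeasurable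
      (hRi.mono' (hm.norm.pow_const q).aestronglyMeasurable ?_)
    filter_upwards [hbd] with x hx
    have : 0 ≤ ‖(z x).1‖ ^ p := by positivity
    rw [Real.norm_of_nonneg (by positivity)]
    linarith

/-- Duality for selfdual integral functionals: a linear form dominated on a subspace by
`F + m` is represented on it by a pair `(A, B)` with `F(A, B) ≤ m`. -/
theorem IsSelfdualIntegrand.exists_dual_pair (h : IsSelfdualIntegrand μ p q ℓ)
    (hpq : p.HolderConjugate q) [Fact (1 ≤ ENNReal.ofReal p)] [Fact (1 ≤ ENNReal.ofReal q)]
    (S : Submodule ℝ (Lp (Eu N) (ENNReal.ofReal p) μ × Lp (Eu N) (ENNReal.ofReal q) μ))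
    (l : Lp (Eu N) (ENNReal.ofReal p) μ × Lp (Eu N) (ENNReal.ofReal q) μ →L[ℝ] ℝ) (m : ℝ)
    (hl : ∀ z ∈ S, l z ≤ integralFunctional μ p q ℓ z + m) :
    ∃ A B : α → Eu N, MemLp A (ENNReal.ofReal p) μ ∧ MemLp B (ENNReal.ofReal q) μ ∧
      (∀ z ∈ S, (∫ x, inner ℝ (B x) (z.1 x) ∂μ) + ∫ x, inner ℝ (A x) (z.2 x) ∂μ = l z) ∧
      ∫ x, ℓ x (A x) (B x) ∂μ ≤ m := by
  -- The extension Λ lies below F + m everywhere and is represented by (B, A), so F*(B, A) ≤ m. By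
  -- selfduality this is the desired F(A, B) ≤ m; it is proved below by testing Λ on measurably
  -- selected, almost optimal fields.
  obtain ⟨Λ, hΛS, hΛ⟩ := exists_dominated_of_convex
    (F := fun z => integralFunctional μ p q ℓ z + m)
    ((h.convexOn hpq).add_const m)
    ((h.continuous hpq).add continuous_const) S l hl
  obtain ⟨B, hB, hBr⟩ := exists_lp_dual hpq (Λ.comp (ContinuousLinearMap.inl ℝ _ _))
  obtain ⟨A, hA, hAr⟩ := exists_lp_dual hpq.symm (Λ.comp (ContinuousLinearMap.inr ℝ _ _))
  have hrep : ∀ z, Λ z = (∫ x, inner ℝ (B x) (z.1 x) ∂μ) + ∫ x, inner ℝ (A x) (z.2 x) ∂μ := by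
    intro z
    rw [← hBr, ← hAr]
    simp only [ContinuousLinearMap.comp_apply, ContinuousLinearMap.inl_apply,
      ContinuousLinearMap.inr_apply]
    rw [← map_add]
    simp
  refine ⟨A, B, hA, hB, fun z hz => by rw [← hrep, hΛS z hz], ?_⟩
  have hAB := h.integrable hpq hA hB
  refine le_of_forall_pos_le_add fun δ hδ => ?_
  -- The added 1 avoids division by zero if the measure is null; ε times the total mass stays below
  -- δ.
  set ε : ℝ := δ / (μ.real Set.univ + 1) with hε
  have hε0 : 0 < ε := by positivity
  obtain ⟨u, w, hu, hw, huw⟩ := h.exists_almost_optimal hpq hA hB hε0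
  have h1 := hΛ (hu.toLp u, hw.toLp w)
  rw [hrep] at h1
  simp only [integralFunctional] at h1
  have e1 : ∫ x, inner ℝ (B x) (hu.toLp u x) ∂μ = ∫ x, inner ℝ (B x) (u x) ∂μ := by
    apply integral_congr_ae
    filter_upwards [hu.coeFn_toLp] with x hx
    rw [hx]
  have e2 : ∫ x, inner ℝ (A x) (hw.toLp w x) ∂μ = ∫ x, inner ℝ (A x) (w x) ∂μ := by
    apply integral_congr_ae
    filter_upwards [hw.coeFn_toLp] with x hx
    rw [hx]
  have e3 : ∫ x, ℓ x (hu.toLp u x) (hw.toLp w x) ∂μ = ∫ x, ℓ x (u x) (w x) ∂μ := by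
    apply integral_congr_ae
    filter_upwards [hu.coeFn_toLp, hw.coeFn_toLp] with x hx hx'
    rw [hx, hx']
  rw [e1, e2, e3] at h1
  have i1 := integrable_inner_of_conj hpq.symm hB hu
  have i2 := integrable_inner_of_conj hpq hA hw
  have i3 := h.integrable hpq hu hw
  have h2 := integral_mono_ae (hAB.sub (integrable_const ε)) ((i1.add i2).sub i3) huw
  simp only [Pi.sub_apply, Pi.add_apply] at h2
  have s1 := integral_sub hAB (integrable_const (μ := μ) ε)
  have s2 := integral_sub (i1.add i2) i3
  have s3 := integral_add i1 i2
  simp only [Pi.add_apply] at s2 s3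
  rw [s1, s2, s3] at h2
  have h3 : ∫ _ : α, ε ∂μ ≤ δ := by
    rw [integral_const, smul_eq_mul, hε, ← mul_div_assoc, div_le_iff₀ (by positivity)]
    nlinarith [measureReal_nonneg (μ := μ) (s := Set.univ)]
  linarith

end Integrand

/-! ### The periodicity cell -/

section Cell

variable {N : ℕ} (x₀ : Eu N) (v : Module.Basis (Fin N) ℝ (Eu N))

/-- The lattice of periods, as an additive subgroup. -/
abbrev lattice (v : Module.Basis (Fin N) ℝ (Eu N)) : AddSubgroup (Eu N) :=
  (Submodule.span ℤ (Set.range v)).toAddSubgroup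

instance : VAddInvariantMeasure (lattice v) (Eu N) volume where
  measure_preimage_vadd c s _ := by
    change volume ((fun x => (c : Eu N) + x) ⁻¹' s) = _
    rw [measure_preimage_add]

instance : MeasurableConstVAdd (lattice v) (Eu N) where
  measurable_const_vadd c := by
    change Measurable fun x => (c : Eu N) + x
    exact measurable_const_add _

instance : Countable (lattice v) :=
  inferInstanceAs <| Countable (Submodule.span ℤ (Set.range v))

lemma basis_mem_lattice (i : Fin N) : v i ∈ lattice v :=
  Submodule.subset_span ⟨i, rfl⟩

lemma exists_int_repr_of_mem_lattice {k : Eu N} (hk : k ∈ lattice v) (i : Fin N) :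
    ∃ n : ℤ, v.repr k i = n := by
  have := (v.mem_span_iff_repr_mem ℤ k).1 hk i
  obtain ⟨n, hn⟩ := this
  exact ⟨n, by simpa using hn.symm⟩

lemma continuous_repr (i : Fin N) : Continuous fun x : Eu N => v.repr x i :=
  (v.coord i).continuous_of_finiteDimensional

lemma isOpen_cell : IsOpen (cell x₀ v) := by
  have : cell x₀ v = ⋂ i, (fun x => v.repr (x - x₀) i) ⁻¹' Set.Ioo 0 1 := by
    ext x; simp [cell]
  rw [this]
  exact isOpen_iInter_of_finite fun i => isOpen_Ioo.preimage
    ((continuous_repr v i).comp (continuous_id.sub continuous_const))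

lemma measurableSet_cell : MeasurableSet (cell x₀ v) := (isOpen_cell x₀ v).measurableSet

lemma norm_sub_le_of_mem_cell {x : Eu N} (hx : x ∈ cell x₀ v) : ‖x - x₀‖ ≤ ∑ i, ‖v i‖ := by
  rw [← v.sum_repr (x - x₀)]
  refine (norm_sum_le _ _).trans (Finset.sum_le_sum fun i _ => ?_)
  rw [norm_smul, Real.norm_eq_abs, abs_of_pos (hx i).1]
  exact mul_le_of_le_one_left (norm_nonneg _) (hx i).2.le

lemma isBounded_cell : Bornology.IsBounded (cell x₀ v) := by
  refine (Metric.isBounded_closedBall (x := x₀) (r := ∑ i, ‖v i‖)).subset fun x hx => ?_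
  rw [mem_closedBall_iff_norm]
  exact norm_sub_le_of_mem_cell x₀ v hx

lemma cell_nonempty : (cell x₀ v).Nonempty := by
  refine ⟨x₀ + ∑ i, (1 / 2 : ℝ) • v i, fun i => ?_⟩
  rw [add_sub_cancel_left, v.repr_sum_self]
  constructor <;> norm_num

instance : IsFiniteMeasure (volume.restrict (cell x₀ v)) :=
  ⟨by rw [Measure.restrict_apply_univ]; exact (isBounded_cell x₀ v).measure_lt_top⟩

lemma volume_cell_ne_zero : volume (cell x₀ v) ≠ 0 :=
  ((isOpen_cell x₀ v).measure_pos volume (cell_nonempty x₀ v)).ne'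

lemma volume_cell_ne_top : volume (cell x₀ v) ≠ ⊤ := (isBounded_cell x₀ v).measure_lt_top.ne

/-- The excluded set is a translate of the kernel of a coordinate form, a proper subspace, hence
null. -/
lemma ae_repr_ne (i : Fin N) (c : ℝ) : ∀ᵐ x : Eu N, v.repr (x - x₀) i ≠ c := by
  have hne : LinearMap.ker (v.coord i) ≠ ⊤ := by
    intro h
    have : v i ∈ LinearMap.ker (v.coord i) := by rw [h]; trivial
    simp at this
  have h0 := Measure.addHaar_submodule (volume : Measure (Eu N)) _ hne
  have h1 : {x : Eu N | ¬ v.repr (x - x₀) i ≠ c} =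
      (fun x => x + -(x₀ + c • v i)) ⁻¹' (LinearMap.ker (v.coord i) : Set (Eu N)) := by
    ext x
    simp only [Set.mem_ofPred_eq, not_not, Set.mem_preimage, SetLike.mem_coe, LinearMap.mem_ker,
      Module.Basis.coord_apply]
    rw [show x + -(x₀ + c • v i) = (x - x₀) - c • v i by abel]
    simp [sub_eq_zero]
  rw [ae_iff, h1, measure_preimage_add_right, h0]

/-- The cell is a fundamental domain of the lattice, up to null sets. -/
lemma isAddFundamentalDomain_cell : IsAddFundamentalDomain (lattice v) (cell x₀ v) volume where
  nullMeasurableSet := (measurableSet_cell x₀ v).nullMeasurableSet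
  ae_covers := by
    -- Off countably many hyperplanes no coordinate is an integer, so the fractional parts land in
    -- the open interval and not merely in [0, 1).
    have h : ∀ᵐ x : Eu N, ∀ (i : Fin N) (n : ℤ), v.repr (x - x₀) i ≠ n :=
      ae_all_iff.2 fun i => ae_all_iff.2 fun n => ae_repr_ne x₀ v i n
    filter_upwards [h] with x hx
    refine ⟨-⟨ZSpan.floor v (x - x₀), (ZSpan.floor v (x - x₀)).2⟩, fun i => ?_⟩
    have : (-(⟨ZSpan.floor v (x - x₀), (ZSpan.floor v (x - x₀)).2⟩ : lattice v) +ᵥ x) - x₀ =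
        ZSpan.fract v (x - x₀) := by
      rw [ZSpan.fract_apply]
      change -(ZSpan.floor v (x - x₀) : Eu N) + x - x₀ = _
      abel
    rw [this, ZSpan.repr_fract_apply]
    refine ⟨lt_of_le_of_ne (Int.fract_nonneg _) fun h0 => ?_, Int.fract_lt_one _⟩
    have := Int.self_sub_fract (v.repr (x - x₀) i)
    rw [← h0, sub_zero] at this
    exact hx i _ this
  aedisjoint := by
    intro g g' hne
    refine Disjoint.aedisjoint (Set.disjoint_left.2 ?_)
    rintro _ ⟨x, hx, rfl⟩ ⟨y, hy, hxy⟩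
    apply hne
    change (g' : Eu N) + y = (g : Eu N) + x at hxy
    apply Subtype.ext
    apply v.ext_elem
    intro i
    obtain ⟨n, hn⟩ := exists_int_repr_of_mem_lattice v g.2 i
    obtain ⟨n', hn'⟩ := exists_int_repr_of_mem_lattice v g'.2 i
    have h1 : v.repr (y - x₀) i - v.repr (x - x₀) i = n - n' := by
      have : y - x₀ = (g : Eu N) - g' + (x - x₀) := by
        rw [eq_comm, ← sub_eq_zero]
        have : (g : Eu N) + x - (g' + y) = 0 := by rw [hxy, sub_self]
        rw [← this]; abel
      rw [this]
      simp [hn, hn']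
    have h2 := hx i
    have h3 := hy i
    -- Coordinates of two points of the open cell differ by less than 1 in absolute value, so an
    -- integer difference is 0.
    have h4 : ((n - n' : ℤ) : ℝ) < 1 := by push_cast; linarith [h2.1, h3.2]
    have h5 : (-1 : ℝ) < ((n - n' : ℤ) : ℝ) := by push_cast; linarith [h2.2, h3.1]
    have h6 : n - n' < 1 := by exact_mod_cast h4
    have h7 : -1 < n - n' := by exact_mod_cast h5
    have : n = n' := by omega
    rw [hn, hn', this]

end Cell

/-! ### Periodic functions -/

section Periodic

variable {N : ℕ} {x₀ : Eu N} {v : Module.Basis (Fin N) ℝ (Eu N)} {F : Type*}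

/-- Periodicity with respect to the lattice spanned by `v`. -/
def IsPeriodic (v : Module.Basis (Fin N) ℝ (Eu N)) (f : Eu N → F) : Prop :=
  ∀ x, ∀ k ∈ lattice v, f (x + k) = f x

lemma IsPeriodic.of_basis {f : Eu N → F} (h : ∀ x i, f (x + v i) = f x) : IsPeriodic v f := by
  intro x k hk
  induction hk using Submodule.span_induction generalizing x with
  | mem k hk => obtain ⟨i, rfl⟩ := hk; exact h x i
  | zero => rw [add_zero]
  | add k k' _ _ h1 h2 => rw [← add_assoc, h2, h1]
  | smul n k _ h1 =>
    induction n using Int.induction_on generalizing x with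
    | zero => simp
    | succ n ih => rw [add_smul, one_smul, ← add_assoc, h1, ih]
    | pred n ih => rw [← ih x, ← h1, sub_smul, one_smul]; congr 1; abel

lemma IsPeriodic.comp {F' : Type*} {f : Eu N → F} (h : IsPeriodic v f) (g : F → F') :
    IsPeriodic v fun x => g (f x) := fun x k hk => by simp only [h x k hk]

lemma IsPeriodic.comp_add {f : Eu N → F} (h : IsPeriodic v f) (a : Eu N) :
    IsPeriodic v fun x => f (x + a) := fun x k hk => by
  simp only
  rw [add_right_comm, h _ k hk]

lemma IsPeriodic.vadd {f : Eu N → F} (h : IsPeriodic v f) (k : lattice v) (x : Eu N) :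
    f (k +ᵥ x) = f x := by
  change f ((k : Eu N) + x) = f x
  rw [add_comm, h x k k.2]

lemma cell_add (h : Eu N) : (fun x => x + h) ⁻¹' cell (x₀ + h) v = cell x₀ v := by
  ext x
  simp [cell]

/-- The translated cell is another fundamental domain of the same lattice, and a periodic function
has the same integral over each. -/
lemma IsPeriodic.setLIntegral_comp_add {f : Eu N → ENNReal} (hf : IsPeriodic v f) (h : Eu N) :
    ∫⁻ x in cell x₀ v, f (x + h) = ∫⁻ x in cell x₀ v, f x := by
  have h1 := (measurePreserving_add_right volume h).setLIntegral_comp_preimage_emb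
    (measurableEmbedding_addRight h) f (cell (x₀ + h) v)
  rw [cell_add] at h1
  rw [h1]
  exact (isAddFundamentalDomain_cell (x₀ + h) v).setLIntegral_eq
    (isAddFundamentalDomain_cell x₀ v) f hf.vadd

lemma IsPeriodic.setIntegral_comp_add [NormedAddCommGroup F] [NormedSpace ℝ F] {f : Eu N → F}
    (hf : IsPeriodic v f) (h : Eu N) :
    ∫ x in cell x₀ v, f (x + h) = ∫ x in cell x₀ v, f x := by
  have h1 := (measurePreserving_add_right volume h).setIntegral_preimage_emb
    (measurableEmbedding_addRight h) f (cell (x₀ + h) v)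
  rw [cell_add] at h1
  rw [h1]
  exact (isAddFundamentalDomain_cell (x₀ + h) v).setIntegral_eq
    (isAddFundamentalDomain_cell x₀ v) hf.vadd

/-- Integrals of periodic functions over bounded sets are controlled by the integral over a cell. -/
lemma exists_setLIntegral_le_of_isBounded (x₀ : Eu N) (v : Module.Basis (Fin N) ℝ (Eu N))
    {K : Set (Eu N)} (hK : Bornology.IsBounded K) (hKm : MeasurableSet K) :
    ∃ n : ℕ, ∀ f : Eu N → ENNReal, IsPeriodic v f →
      ∫⁻ x in K, f x ≤ n * ∫⁻ x in cell x₀ v, f x := by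
  -- Only finitely many lattice translates of the cell meet `K`; their number is the constant.
  have hfin : {g : lattice v | ∃ x ∈ cell x₀ v, (g : Eu N) + x ∈ K}.Finite := by
    have h1 := ZSpan.setFinite_inter v (hK.sub (isBounded_cell x₀ v))
    refine Set.Finite.of_finite_image (f := Subtype.val) (h1.subset ?_) Subtype.val_injective.injOn
    rintro _ ⟨g, ⟨x, hx, hgx⟩, rfl⟩
    exact ⟨Set.mem_sub.2 ⟨_, hgx, x, hx, by simp⟩, g.2⟩
  refine ⟨hfin.toFinset.card, fun f hf => ?_⟩
  rw [← lintegral_indicator hKm, (isAddFundamentalDomain_cell x₀ v).lintegral_eq_tsum'',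
    tsum_eq_sum (s := hfin.toFinset)]
  · rw [← nsmul_eq_mul]
    refine Finset.sum_le_card_nsmul _ _ _ fun g _ => ?_
    refine lintegral_mono fun x => ?_
    refine (Set.indicator_le_self _ _ _).trans ?_
    rw [hf.vadd]
  · intro g hg
    rw [Set.Finite.mem_toFinset] at hg
    rw [setLIntegral_congr_fun (g := fun _ => 0) (measurableSet_cell x₀ v), lintegral_zero]
    intro x hx
    refine Set.indicator_of_notMem (fun hgx => hg ⟨x, hx, hgx⟩) _

/-- The periodic retraction onto the (half-open) cell with corner `x₀`. -/
def cellFract (x₀ : Eu N) (v : Module.Basis (Fin N) ℝ (Eu N)) (x : Eu N) : Eu N :=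
  x₀ + ZSpan.fract v (x - x₀)

lemma measurable_cellFract : Measurable (cellFract x₀ v) := by
  have : cellFract x₀ v = fun x => x₀ + ∑ i, Int.fract (v.repr (x - x₀) i) • v i := by
    ext1 x
    rw [cellFract, ← v.sum_repr (ZSpan.fract v (x - x₀))]
    simp only [ZSpan.repr_fract_apply]
  rw [this]
  refine measurable_const.add (Finset.measurable_sum _ fun i _ => ?_)
  exact (measurable_fract.comp (((continuous_repr v i).measurable).comp
    (measurable_id.sub_const x₀))).smul_const _

lemma cellFract_eq_add (x : Eu N) : ∃ k ∈ lattice v, cellFract x₀ v x = x + k := by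
  refine ⟨-(ZSpan.floor v (x - x₀) : Eu N), (lattice v).neg_mem (ZSpan.floor v (x - x₀)).2, ?_⟩
  rw [cellFract, ZSpan.fract_apply]
  abel

lemma isPeriodic_cellFract : IsPeriodic v (cellFract x₀ v) := by
  intro x k hk
  rw [cellFract, cellFract, add_sub_right_comm, ZSpan.fract_add_ZSpan v _ hk]

lemma cellFract_of_mem_cell {x : Eu N} (hx : x ∈ cell x₀ v) : cellFract x₀ v x = x := by
  rw [cellFract, ZSpan.fract_eq_self.2, add_sub_cancel]
  rw [ZSpan.mem_fundamentalDomain]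
  exact fun i => ⟨(hx i).1.le, (hx i).2⟩

/-- Evaluating a measurable representative at the retraction onto one cell makes it periodic
everywhere. The lattice being countable, the exceptional null sets can be discarded for all periods
at once, so the function changes only on a null set. -/
lemma exists_periodic_stronglyMeasurable [TopologicalSpace F] {f : Eu N → F}
    (hf : AEStronglyMeasurable f volume) (hp : ∀ i, ∀ᵐ x, f (x + v i) = f x) :
    ∃ g : Eu N → F, StronglyMeasurable g ∧ IsPeriodic v g ∧ f =ᵐ[volume] g := by
  have hqmp : ∀ a : Eu N, Measure.QuasiMeasurePreserving (fun x => x + a) volume volume :=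
    fun a => (measurePreserving_add_right volume a).quasiMeasurePreserving
  have hall : ∀ k ∈ lattice v, ∀ᵐ x, f (x + k) = f x := by
    intro k hk
    induction hk using Submodule.span_induction with
    | mem k hk => obtain ⟨i, rfl⟩ := hk; exact hp i
    | zero => simp
    | add k k' _ _ h1 h2 =>
      filter_upwards [h1, (hqmp k).ae h2] with x hx hx'
      rw [← add_assoc, hx', hx]
    | smul n k _ h1 =>
      induction n using Int.induction_on with
      | zero => simp
      | succ n ih =>
        filter_upwards [ih, (hqmp ((n : ℤ) • k)).ae h1] with x hx hx'
        rw [add_smul, one_smul, ← add_assoc, hx', hx]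
      | pred n ih =>
        filter_upwards [ih, (hqmp ((-(n : ℤ) - 1) • k)).ae h1] with x hx hx'
        rw [← hx', ← hx, sub_smul, one_smul]
        congr 1
        abel
  have hall' : ∀ᵐ x, ∀ k : lattice v, f (x + k) = hf.mk f (x + k) ∧ f (x + k) = f x :=
    ae_all_iff.2 fun k => by
      filter_upwards [(hqmp k).ae hf.ae_eq_mk, hall k k.2] with x h1 h2 using ⟨h1, h2⟩
  refine ⟨fun x => hf.mk f (cellFract 0 v x),
    hf.stronglyMeasurable_mk.comp_measurable measurable_cellFract,
    isPeriodic_cellFract.comp _, ?_⟩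
  filter_upwards [hall'] with x hx
  obtain ⟨k, hk, he⟩ := cellFract_eq_add (x₀ := 0) (v := v) x
  obtain ⟨h1, h2⟩ := hx ⟨k, hk⟩
  rw [he, ← h1, h2]

end Periodic

/-! ### Translations and weak gradients -/

section Translation

variable {N : ℕ}

/-- Lebesgue measure on the unit interval. -/
abbrev unitMeasure : Measure ℝ := volume.restrict (Set.Ioc (0 : ℝ) 1)

/-- Each slice is a translation. This transfers integrability between the two forms of the integrand
in `integral_segment_mul`. -/
lemma measurePreserving_shear (h : Eu N) :
    MeasurePreserving (fun z : ℝ × Eu N => (z.1, z.2 + z.1 • h))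
      (unitMeasure.prod volume) (unitMeasure.prod volume) := by
  refine MeasurePreserving.skew_product (g := fun t x => x + t • h)
    (MeasurePreserving.id unitMeasure) ?_ ?_
  · exact measurable_snd.add (measurable_fst.smul_const h)
  · exact ae_of_all _ fun t => (measurePreserving_add_right volume (t • h)).map_eq

variable {f ψ : Eu N → ℝ} {C R : ℝ}

lemma integrable_mul_comp_sub_smul (hf : LocallyIntegrable f volume) (hψ : Measurable ψ)
    (hC : ∀ x, |ψ x| ≤ C) (hR : ∀ x, R < ‖x‖ → ψ x = 0) (h : Eu N) :
    Integrable (fun z : ℝ × Eu N => f z.2 * ψ (z.2 - z.1 • h)) (unitMeasure.prod volume) := by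
  have hC0 : 0 ≤ C := (abs_nonneg _).trans (hC 0)
  set K := Metric.closedBall (0 : Eu N) (R + ‖h‖)
  have hK : IntegrableOn f K volume := hf.integrableOn_isCompact (isCompact_closedBall _ _)
  have hi : Integrable (K.indicator fun x => C * |f x|) volume :=
    IntegrableOn.integrable_indicator (hK.abs.const_mul C) measurableSet_closedBall
  refine (hi.comp_snd unitMeasure).mono' ?_ ?_
  · refine hf.aestronglyMeasurable.comp_snd.mul (Measurable.aestronglyMeasurable ?_)
    exact hψ.comp (measurable_snd.sub (measurable_fst.smul_const h))
  · have hprod : ∀ᵐ z ∂unitMeasure.prod (volume : Measure (Eu N)), z.1 ∈ Set.Ioc (0 : ℝ) 1 :=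
      Measure.quasiMeasurePreserving_fst.ae (ae_restrict_mem measurableSet_Ioc)
    filter_upwards [hprod] with z hz
    rw [norm_mul, Real.norm_eq_abs, Real.norm_eq_abs]
    by_cases hzK : z.2 ∈ K
    · rw [Set.indicator_of_mem hzK, mul_comm]
      gcongr
      exact hC _
    · rw [Set.indicator_of_notMem hzK, hR, abs_zero, mul_zero]
      rw [mem_closedBall_zero_iff, not_le] at hzK
      have h1 : ‖z.1 • h‖ ≤ ‖h‖ := by
        rw [norm_smul, Real.norm_eq_abs, abs_of_pos hz.1]
        exact mul_le_of_le_one_left (norm_nonneg _) hz.2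
      have h2 := norm_sub_norm_le z.2 (z.1 • h)
      linarith

lemma integrable_comp_add_smul_mul (hf : LocallyIntegrable f volume) (hψ : Measurable ψ)
    (hC : ∀ x, |ψ x| ≤ C) (hR : ∀ x, R < ‖x‖ → ψ x = 0) (h : Eu N) :
    Integrable (fun z : ℝ × Eu N => f (z.2 + z.1 • h) * ψ z.2) (unitMeasure.prod volume) := by
  have h1 := (measurePreserving_shear h).integrable_comp_of_integrable
    (integrable_mul_comp_sub_smul hf hψ hC hR h)
  refine h1.congr (ae_of_all _ fun z => ?_)
  simp

/-- Averages over segments of length `h`, tested against a bounded function. -/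
lemma integral_segment_mul (hf : LocallyIntegrable f volume) (hψ : Measurable ψ)
    (hC : ∀ x, |ψ x| ≤ C) (hR : ∀ x, R < ‖x‖ → ψ x = 0) (h : Eu N) :
    ∫ x, (∫ t, f (x + t • h) ∂unitMeasure) * ψ x =
      ∫ t, (∫ x, f x * ψ (x - t • h)) ∂unitMeasure := by
  have h1 := integrable_comp_add_smul_mul hf hψ hC hR h
  have h2 := integral_integral_swap (f := fun t x => f (x + t • h) * ψ x) h1
  simp_rw [← integral_mul_const]
  rw [← h2]
  congr 1
  ext t
  have := integral_add_right_eq_self (μ := (volume : Measure (Eu N)))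
    (fun x => f x * ψ (x - t • h)) (t • h)
  rw [← this]
  simp

lemma locallyIntegrable_segment (hf : LocallyIntegrable f volume) (h : Eu N) :
    LocallyIntegrable (fun x => ∫ t, f (x + t • h) ∂unitMeasure) volume := by
  rw [locallyIntegrable_iff]
  intro K hK
  obtain ⟨R, hR⟩ := hK.isBounded.exists_norm_le
  have h1 := integrable_comp_add_smul_mul (ψ := K.indicator fun _ => 1) (C := 1) (R := R) hf
    (measurable_const.indicator hK.measurableSet)
    (fun x => by by_cases hx : x ∈ K <;> simp [hx])
    (fun x hx => Set.indicator_of_notMem (fun hxK => absurd (hR x hxK) (not_le.2 hx)) _) h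
  have h2 := h1.integral_prod_right
  rw [← integrable_indicator_iff hK.measurableSet]
  refine h2.congr (ae_of_all _ fun x => ?_)
  simp only
  rw [integral_mul_const]
  by_cases hx : x ∈ K <;> simp [hx]

lemma locallyIntegrable_comp_add {F : Type*} [NormedAddCommGroup F] {f : Eu N → F}
    (hf : LocallyIntegrable f volume) (h : Eu N) :
    LocallyIntegrable (fun x => f (x + h)) volume := by
  rw [locallyIntegrable_iff]
  intro K hK
  have h1 : IntegrableOn f ((fun x => x + h) '' K) volume :=
    hf.integrableOn_isCompact (hK.image (continuous_add_const h))
  have h2 := ((measurePreserving_add_right volume h).integrableOn_image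
    (measurableEmbedding_addRight h) (f := f) (s := K)).1 h1
  exact h2

lemma HasWeakGradient.integral_mul_comp_sub {φ : Eu N → ℝ} {G : Eu N → Eu N}
    (hφ : HasWeakGradient φ G) {θ : Eu N → ℝ} (hθ : ContDiff ℝ ∞ θ) (hs : HasCompactSupport θ)
    (a w : Eu N) :
    ∫ x, φ x * fderiv ℝ θ (x - a) w = -∫ x, inner ℝ (G x) w * θ (x - a) := by
  have hθ' : ContDiff ℝ ∞ fun x => θ (x - a) := hθ.comp (contDiff_id.sub contDiff_const)
  have hs' : HasCompactSupport fun x => θ (x - a) :=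
    hs.comp_homeomorph (Homeomorph.subRight a)
  have := hφ.integral_eq _ hθ' hs' w
  simp only [fderiv_comp_sub] at this
  exact this

/-- The fundamental theorem of calculus for weak gradients. -/
theorem HasWeakGradient.translation_ae_eq {φ : Eu N → ℝ} {G : Eu N → Eu N}
    (hφ : HasWeakGradient φ G) (h : Eu N) :
    ∀ᵐ x, φ (x + h) - φ x = ∫ t, inner ℝ (G (x + t • h)) h ∂unitMeasure := by
  have hG : LocallyIntegrable (fun x => inner ℝ (G x) h) volume := by
    have := hφ.locallyIntegrable_grad
    rw [locallyIntegrable_iff] at this ⊢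
    intro K hK
    exact Integrable.inner_const (this K hK) h
  -- After testing against a smooth θ, the translation moves onto θ, where the classical fundamental
  -- theorem applies to t ↦ θ(x - t h). Fubini and the definition of the weak gradient, applied to
  -- each translate of θ, bring the result back to `G`.
  refine ae_eq_of_integral_contDiff_smul_eq
    ((locallyIntegrable_comp_add hφ.locallyIntegrable h).sub hφ.locallyIntegrable)
    (locallyIntegrable_segment hG h) fun θ hθ hs => ?_
  obtain ⟨R, hR⟩ := hs.isCompact.isBounded.exists_norm_le
  have hR0 : ∀ x, R < ‖x‖ → θ x = 0 := fun x hx =>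
    image_eq_zero_of_notMem_tsupport fun hx' => absurd (hR x hx') (not_le.2 hx)
  obtain ⟨C, hC⟩ := hs.exists_bound_of_continuous hθ.continuous
  have hdc : Continuous fun x => fderiv ℝ θ x h :=
    (hθ.continuous_fderiv (by simp)).clm_apply continuous_const
  have hds : HasCompactSupport fun x => fderiv ℝ θ x h := by
    exact (hs.fderiv ℝ).comp_left (g := fun L : Eu N →L[ℝ] ℝ => L h) (by simp)
  obtain ⟨C', hC'⟩ := hds.exists_bound_of_continuous hdc
  have hR0' : ∀ x, R < ‖x‖ → fderiv ℝ θ x h = 0 := fun x hx => by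
    have : fderiv ℝ θ x = 0 := image_eq_zero_of_notMem_tsupport fun hx' =>
      absurd (hR x (tsupport_fderiv_subset ℝ hx')) (not_le.2 hx)
    rw [this]; rfl
  have hftc : ∀ x, θ (x - h) - θ x = -∫ t, fderiv ℝ θ (x - t • h) h ∂unitMeasure := by
    intro x
    have hd : ∀ t ∈ Set.uIcc (0 : ℝ) 1,
        HasDerivAt (fun t : ℝ => θ (x - t • h)) (-fderiv ℝ θ (x - t • h) h) t := by
      intro t _
      have h1 : HasDerivAt (fun t : ℝ => x - t • h) (-h) t := by
        simpa using ((hasDerivAt_id t).smul_const h).const_sub x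
      have h2 := (hθ.differentiable (by simp) (x - t • h)).hasFDerivAt.comp_hasDerivAt t h1
      rw [map_neg] at h2
      exact h2
    have hc : Continuous fun t : ℝ => -fderiv ℝ θ (x - t • h) h :=
      (hdc.comp (continuous_const.sub (continuous_id.smul continuous_const))).neg
    have := intervalIntegral.integral_eq_sub_of_hasDerivAt hd (hc.intervalIntegrable 0 1)
    rw [intervalIntegral.integral_of_le zero_le_one, integral_neg] at this
    rw [this]
    simp
  have i1 : Integrable (fun x => φ x * θ (x - h)) := by
    have := hφ.locallyIntegrable.integrable_smul_left_of_hasCompactSupport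
      (hθ.continuous.comp (continuous_id.sub continuous_const))
      (hs.comp_homeomorph (Homeomorph.subRight h))
    refine this.congr (ae_of_all _ fun x => ?_)
    simp [mul_comm]
  have i2 : Integrable (fun x => φ x * θ x) := by
    have := hφ.locallyIntegrable.integrable_smul_left_of_hasCompactSupport hθ.continuous hs
    refine this.congr (ae_of_all _ fun x => ?_)
    simp [mul_comm]
  have i3 : Integrable (fun x => φ (x + h) * θ x) := by
    have := (locallyIntegrable_comp_add hφ.locallyIntegrable
      h).integrable_smul_left_of_hasCompactSupport hθ.continuous hs
    refine this.congr (ae_of_all _ fun x => ?_)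
    simp [mul_comm]
  have e1 : ∫ x, θ x • (φ (x + h) - φ x) = ∫ x, φ x * (θ (x - h) - θ x) := by
    simp_rw [smul_eq_mul, mul_sub, fun x => mul_comm (θ x)]
    rw [integral_sub i3 i2, integral_sub i1 i2]
    congr 1
    rw [← integral_add_right_eq_self (μ := (volume : Measure (Eu N)))
      (fun x => φ x * θ (x - h)) h]
    simp
  have e2 : ∫ x, φ x * (θ (x - h) - θ x) =
      -∫ t, (∫ x, φ x * fderiv ℝ θ (x - t • h) h) ∂unitMeasure := by
    have h1 := integral_integral_swap (f := fun t x => φ x * fderiv ℝ θ (x - t • h) h)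
      (integrable_mul_comp_sub_smul hφ.locallyIntegrable hdc.measurable hC' hR0' h)
    rw [h1, ← integral_neg]
    congr 1
    ext x
    rw [hftc, integral_const_mul]
    ring
  have e3 : ∫ x, θ x • ∫ t, inner ℝ (G (x + t • h)) h ∂unitMeasure =
      ∫ t, (∫ x, inner ℝ (G x) h * θ (x - t • h)) ∂unitMeasure := by
    rw [← integral_segment_mul hG hθ.continuous.measurable hC hR0 h]
    simp_rw [smul_eq_mul, fun x => mul_comm (θ x)]
  rw [e1, e2, e3, ← integral_neg]
  congr 1
  ext t
  rw [hφ.integral_mul_comp_sub hθ hs, neg_neg]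

/-- Weak gradients are unique. -/
lemma HasWeakGradient.ae_unique {φ : Eu N → ℝ} {G G' : Eu N → Eu N}
    (h : HasWeakGradient φ G) (h' : HasWeakGradient φ G') : G =ᵐ[volume] G' := by
  refine ae_eq_of_integral_contDiff_smul_eq h.locallyIntegrable_grad h'.locallyIntegrable_grad
    fun θ hθ hs => ?_
  have i1 := h.locallyIntegrable_grad.integrable_smul_left_of_hasCompactSupport hθ.continuous hs
  have i2 := h'.locallyIntegrable_grad.integrable_smul_left_of_hasCompactSupport hθ.continuous hs
  refine ext_inner_left ℝ fun w => ?_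
  rw [← integral_inner i1, ← integral_inner i2]
  have e1 := h.integral_eq θ hθ hs w
  rw [h'.integral_eq θ hθ hs w, neg_inj] at e1
  simp_rw [inner_smul_right, real_inner_comm _ w, fun x => mul_comm (θ x)]
  exact e1.symm

lemma HasWeakGradient.congr {φ φ' : Eu N → ℝ} {G G' : Eu N → Eu N} (h : HasWeakGradient φ G)
    (hφ : φ =ᵐ[volume] φ') (hG : G =ᵐ[volume] G') : HasWeakGradient φ' G' where
  locallyIntegrable := h.locallyIntegrable.congr hφ
  locallyIntegrable_grad := h.locallyIntegrable_grad.congr hG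
  integral_eq θ hθ hs w := by
    have := h.integral_eq θ hθ hs w
    have e1 : ∫ x, φ x * fderiv ℝ θ x w = ∫ x, φ' x * fderiv ℝ θ x w :=
      integral_congr_ae (by filter_upwards [hφ] with x hx; rw [hx])
    have e2 : ∫ x, inner ℝ (G x) w * θ x = ∫ x, inner ℝ (G' x) w * θ x :=
      integral_congr_ae (by filter_upwards [hG] with x hx; rw [hx])
    rw [← e1, ← e2, this]

lemma HasWeakGradient.comp_add {φ : Eu N → ℝ} {G : Eu N → Eu N} (h : HasWeakGradient φ G)
    (a : Eu N) : HasWeakGradient (fun x => φ (x + a)) fun x => G (x + a) where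
  locallyIntegrable := locallyIntegrable_comp_add h.locallyIntegrable a
  locallyIntegrable_grad := locallyIntegrable_comp_add h.locallyIntegrable_grad a
  integral_eq θ hθ hs w := by
    have := h.integral_mul_comp_sub hθ hs a w
    rw [← integral_add_right_eq_self (μ := (volume : Measure (Eu N)))
      (fun x => φ x * fderiv ℝ θ (x - a) w) a, ← integral_add_right_eq_self
      (μ := (volume : Measure (Eu N))) (fun x => inner ℝ (G x) w * θ (x - a)) a] at this
    simpa using this

end Translation

/-! ### Periodic Sobolev functions -/

section Sobolev

variable {N : ℕ} {x₀ : Eu N} {v : Module.Basis (Fin N) ℝ (Eu N)} {p q : ℝ}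

lemma HasWeakGradient.add {φ φ' : Eu N → ℝ} {G G' : Eu N → Eu N} (h : HasWeakGradient φ G)
    (h' : HasWeakGradient φ' G') :
    HasWeakGradient (fun x => φ x + φ' x) (fun x => G x + G' x) where
  locallyIntegrable := h.locallyIntegrable.add h'.locallyIntegrable
  locallyIntegrable_grad := h.locallyIntegrable_grad.add h'.locallyIntegrable_grad
  integral_eq θ hθ hs w := by
    have hdc : Continuous fun x => fderiv ℝ θ x w :=
      (hθ.continuous_fderiv (by simp)).clm_apply continuous_const
    have hds : HasCompactSupport fun x => fderiv ℝ θ x w :=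
      (hs.fderiv ℝ).comp_left (g := fun L : Eu N →L[ℝ] ℝ => L w) (by simp)
    have i1 : ∀ f : Eu N → ℝ, LocallyIntegrable f volume →
        Integrable fun x => f x * fderiv ℝ θ x w := fun f hf =>
      (hf.integrable_smul_left_of_hasCompactSupport hdc hds).congr
        (ae_of_all _ fun x => by simp [mul_comm])
    have i2 : ∀ f : Eu N → Eu N, LocallyIntegrable f volume →
        Integrable fun x => inner ℝ (f x) w * θ x := fun f hf =>
      ((hf.integrable_smul_left_of_hasCompactSupport hθ.continuous hs).inner_const w).congr
        (ae_of_all _ fun x => by simp [inner_smul_left, mul_comm])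
    simp_rw [inner_add_left, add_mul]
    rw [integral_add (i1 _ h.locallyIntegrable) (i1 _ h'.locallyIntegrable),
      integral_add (i2 _ h.locallyIntegrable_grad) (i2 _ h'.locallyIntegrable_grad),
      h.integral_eq θ hθ hs w, h'.integral_eq θ hθ hs w]
    ring

lemma HasWeakGradient.const_smul {φ : Eu N → ℝ} {G : Eu N → Eu N} (h : HasWeakGradient φ G)
    (c : ℝ) : HasWeakGradient (fun x => c * φ x) (fun x => c • G x) where
  locallyIntegrable := h.locallyIntegrable.smul c
  locallyIntegrable_grad := h.locallyIntegrable_grad.smul c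
  integral_eq θ hθ hs w := by
    simp_rw [inner_smul_left, mul_assoc, integral_const_mul]
    rw [h.integral_eq θ hθ hs w]
    simp

lemma hasWeakGradient_zero : HasWeakGradient (fun _ : Eu N => 0) (fun _ => 0) where
  locallyIntegrable := locallyIntegrable_const 0
  locallyIntegrable_grad := locallyIntegrable_const 0
  integral_eq θ _ _ w := by simp

lemma isPeriodicSobolev_zero : IsPeriodicSobolev x₀ v p (fun _ => 0) (fun _ => 0) where
  periodic _ _ := rfl
  weakGradient := hasWeakGradient_zero
  memLp := MemLp.zero
  memLp_grad := MemLp.zero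
  integral_eq_zero := by simp

namespace IsPeriodicSobolev

variable {φ φ' : Eu N → ℝ} {G G' : Eu N → Eu N}

lemma isPeriodic (h : IsPeriodicSobolev x₀ v p φ G) : IsPeriodic v φ := .of_basis h.periodic

lemma congr (h : IsPeriodicSobolev x₀ v p φ G) (hφ : φ =ᵐ[volume] φ') (hG : G =ᵐ[volume] G')
    (hper : IsPeriodic v φ') : IsPeriodicSobolev x₀ v p φ' G' where
  periodic x i := hper x _ (basis_mem_lattice v i)
  weakGradient := h.weakGradient.congr hφ hG
  memLp := h.memLp.ae_eq (ae_restrict_of_ae hφ)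
  memLp_grad := h.memLp_grad.ae_eq (ae_restrict_of_ae hG)
  integral_eq_zero := by
    rw [← integral_congr_ae (ae_restrict_of_ae hφ), h.integral_eq_zero]

lemma integrableOn (h : IsPeriodicSobolev x₀ v p φ G) : IntegrableOn φ (cell x₀ v) volume :=
  (h.weakGradient.locallyIntegrable.integrableOn_isCompact
    (isBounded_cell x₀ v).isCompact_closure).mono_set subset_closure

lemma add (h : IsPeriodicSobolev x₀ v p φ G) (h' : IsPeriodicSobolev x₀ v p φ' G') :
    IsPeriodicSobolev x₀ v p (fun x => φ x + φ' x) (fun x => G x + G' x) where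
  periodic x i := by rw [h.periodic, h'.periodic]
  weakGradient := h.weakGradient.add h'.weakGradient
  memLp := h.memLp.add h'.memLp
  memLp_grad := h.memLp_grad.add h'.memLp_grad
  integral_eq_zero := by
    rw [integral_add h.integrableOn h'.integrableOn, h.integral_eq_zero, h'.integral_eq_zero,
      add_zero]

lemma const_smul (h : IsPeriodicSobolev x₀ v p φ G) (c : ℝ) :
    IsPeriodicSobolev x₀ v p (fun x => c * φ x) (fun x => c • G x) where
  periodic x i := by rw [h.periodic]
  weakGradient := h.weakGradient.const_smul c
  memLp := h.memLp.const_mul c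
  memLp_grad := h.memLp_grad.const_smul c
  integral_eq_zero := by rw [integral_const_mul, h.integral_eq_zero, mul_zero]

lemma sub (h : IsPeriodicSobolev x₀ v p φ G) (h' : IsPeriodicSobolev x₀ v p φ' G') :
    IsPeriodicSobolev x₀ v p (fun x => φ x - φ' x) (fun x => G x - G' x) := by
  simpa [sub_eq_add_neg] using h.add (h'.const_smul (-1))

/-- Measurable, everywhere periodic representatives. -/
lemma exists_representative (h : IsPeriodicSobolev x₀ v p φ G) :
    ∃ φ' G', StronglyMeasurable φ' ∧ StronglyMeasurable G' ∧ IsPeriodic v φ' ∧ IsPeriodic v G' ∧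
      φ =ᵐ[volume] φ' ∧ G =ᵐ[volume] G' ∧ IsPeriodicSobolev x₀ v p φ' G' := by
  obtain ⟨φ', m1, p1, e1⟩ := exists_periodic_stronglyMeasurable (v := v)
    h.weakGradient.locallyIntegrable.aestronglyMeasurable
    (fun i => ae_of_all _ fun x => h.periodic x i)
  have hG : ∀ i, ∀ᵐ x, G (x + v i) = G x := fun i => by
    have h1 := h.weakGradient.comp_add (v i)
    simp_rw [h.periodic] at h1
    exact h1.ae_unique h.weakGradient
  obtain ⟨G', m2, p2, e2⟩ := exists_periodic_stronglyMeasurable (v := v)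
    h.weakGradient.locallyIntegrable_grad.aestronglyMeasurable hG
  exact ⟨φ', G', m1, m2, p1, p2, e1, e2, h.congr e1 e2 p1⟩

/-- The gradient of a periodic function has mean zero. -/
lemma integral_grad_eq_zero (h : IsPeriodicSobolev x₀ v p φ G) : ∫ x in cell x₀ v, G x = 0 := by
  obtain ⟨φ', G', m1, m2, p1, p2, e1, e2, h'⟩ := h.exists_representative
  rw [integral_congr_ae (ae_restrict_of_ae e2)]
  have hGi : IntegrableOn G' (cell x₀ v) volume :=
    (h'.weakGradient.locallyIntegrable_grad.integrableOn_isCompact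
      (isBounded_cell x₀ v).isCompact_closure).mono_set subset_closure
  refine ext_inner_left ℝ fun w => ?_
  rw [← integral_inner hGi, inner_zero_right]
  have hloc : LocallyIntegrable (fun x => inner ℝ (G' x) w) volume := by
    have := h'.weakGradient.locallyIntegrable_grad
    rw [locallyIntegrable_iff] at this ⊢
    intro K hK
    exact Integrable.inner_const (this K hK) w
  obtain ⟨R, hR⟩ := (isBounded_cell x₀ v).exists_norm_le
  -- The fundamental theorem in direction `w` is integrated over the cell. By periodicity the
  -- increments of φ integrate to 0, while every translate of ⟨G, w⟩ has the same integral; hence ⟨∫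
  -- G, w⟩ = 0. Only boundedness of the indicator matters here, not smoothness.
  have h1 := integral_segment_mul (ψ := (cell x₀ v).indicator fun _ => 1) (C := 1) (R := R) hloc
    (measurable_const.indicator (measurableSet_cell x₀ v))
    (fun x => by by_cases hx : x ∈ cell x₀ v <;> simp [hx])
    (fun x hx => Set.indicator_of_notMem (fun hxK => absurd (hR x hxK) (not_le.2 hx)) _) w
  have hind : ∀ (f : Eu N → ℝ), ∫ x, f x * (cell x₀ v).indicator (fun _ => 1) x =
      ∫ x in cell x₀ v, f x := by
    intro f
    rw [← integral_indicator (measurableSet_cell x₀ v)]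
    congr 1
    ext x
    by_cases hx : x ∈ cell x₀ v <;> simp [hx]
  rw [hind] at h1
  have h2 : ∀ t : ℝ, ∫ x, inner ℝ (G' x) w * (cell x₀ v).indicator (fun _ => (1 : ℝ)) (x - t • w) =
      ∫ x in cell x₀ v, inner ℝ (G' x) w := by
    intro t
    rw [← integral_add_right_eq_self (μ := (volume : Measure (Eu N))) _ (t • w)]
    simp only [add_sub_cancel_right]
    rw [hind]
    exact (p2.comp fun y => inner ℝ y w).setIntegral_comp_add (t • w)
  simp_rw [h2] at h1
  rw [integral_const, ← integral_congr_ae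
    (ae_restrict_of_ae (h'.weakGradient.translation_ae_eq w))] at h1
  have hi : IntegrableOn (fun x => φ' (x + w)) (cell x₀ v) volume :=
    ((locallyIntegrable_comp_add h'.weakGradient.locallyIntegrable w).integrableOn_isCompact
    (isBounded_cell x₀ v).isCompact_closure).mono_set subset_closure
  rw [integral_sub hi h'.integrableOn, p1.setIntegral_comp_add, sub_self] at h1
  simp_rw [real_inner_comm _ w] at h1 ⊢
  simpa using h1.symm

end IsPeriodicSobolev

/-- Jensen's inequality for powers. -/
lemma lintegral_rpow_le_rpow {α : Type*} [MeasurableSpace α] {μ : Measure α}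
    (hpq : p.HolderConjugate q) {f : α → ENNReal} (hf : AEMeasurable f μ) :
    (∫⁻ x, f x ∂μ) ^ p ≤ μ Set.univ ^ (p / q) * ∫⁻ x, f x ^ p ∂μ := by
  have h := ENNReal.lintegral_mul_le_Lp_mul_Lq μ hpq hf (aemeasurable_const (b := (1 : ENNReal)))
  simp only [Pi.mul_apply, mul_one, ENNReal.one_rpow, lintegral_const, one_mul] at h
  calc (∫⁻ x, f x ∂μ) ^ p
      ≤ ((∫⁻ x, f x ^ p ∂μ) ^ (1 / p) * μ Set.univ ^ (1 / q)) ^ p :=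
        ENNReal.rpow_le_rpow h hpq.pos.le
    _ = _ := by
        rw [ENNReal.mul_rpow_of_nonneg _ _ hpq.pos.le, ← ENNReal.rpow_mul, ← ENNReal.rpow_mul,
          one_div_mul_cancel hpq.pos.ne', ENNReal.rpow_one, mul_comm]
        congr 2
        field_simp

/-- The increment is an average of ⟨G, a⟩ along a segment. Jensen bounds its p-th power, and after
exchanging integrals periodicity removes the shift for each t. -/
lemma IsPeriodicSobolev.lintegral_translation_le (hpq : p.HolderConjugate q) {φ : Eu N → ℝ}
    {G : Eu N → Eu N} (h : IsPeriodicSobolev x₀ v p φ G) (hG : StronglyMeasurable G)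
    (hGp : IsPeriodic v G) (a : Eu N) :
    ∫⁻ x in cell x₀ v, ‖φ (x + a) - φ x‖ₑ ^ p ≤ ‖a‖ₑ ^ p * ∫⁻ x in cell x₀ v, ‖G x‖ₑ ^ p := by
  have hm : Measurable fun z : Eu N × ℝ => ‖G (z.1 + z.2 • a)‖ₑ :=
    (hG.comp_measurable (measurable_fst.add (measurable_snd.smul_const a))).enorm
  have hν : unitMeasure Set.univ = 1 := by simp
  calc ∫⁻ x in cell x₀ v, ‖φ (x + a) - φ x‖ₑ ^ p
      ≤ ∫⁻ x in cell x₀ v, ∫⁻ t, (‖a‖ₑ * ‖G (x + t • a)‖ₑ) ^ p ∂unitMeasure := by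
        refine lintegral_mono_ae (ae_restrict_of_ae ?_)
        filter_upwards [h.weakGradient.translation_ae_eq a] with x hx
        rw [hx]
        have h1 : ‖∫ t, inner ℝ (G (x + t • a)) a ∂unitMeasure‖ₑ ≤
            ∫⁻ t, ‖a‖ₑ * ‖G (x + t • a)‖ₑ ∂unitMeasure := by
          refine (enorm_integral_le_lintegral_enorm _).trans (lintegral_mono fun t => ?_)
          rw [mul_comm]
          simp only [← ofReal_norm]
          rw [← ENNReal.ofReal_mul (norm_nonneg _)]
          exact ENNReal.ofReal_le_ofReal (norm_inner_le_norm _ _)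
        refine (ENNReal.rpow_le_rpow h1 hpq.pos.le).trans ?_
        refine (lintegral_rpow_le_rpow hpq ?_).trans (le_of_eq ?_)
        · exact ((hm.comp measurable_prodMk_left).const_mul _).aemeasurable
        · rw [hν, ENNReal.one_rpow, one_mul]
    _ = ∫⁻ t, (∫⁻ x in cell x₀ v, (‖a‖ₑ * ‖G (x + t • a)‖ₑ) ^ p) ∂unitMeasure :=
        lintegral_lintegral_swap ((hm.const_mul _).pow_const p).aemeasurable
    _ = ∫⁻ _ : ℝ, ‖a‖ₑ ^ p * (∫⁻ x in cell x₀ v, ‖G x‖ₑ ^ p) ∂unitMeasure := by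
        congr 1
        ext t
        simp_rw [ENNReal.mul_rpow_of_nonneg _ _ hpq.pos.le]
        have hmt : Measurable fun x => ‖G (x + t • a)‖ₑ ^ p :=
          (hm.comp (measurable_prodMk_right (y := t))).pow_const p
        rw [lintegral_const_mul _ hmt, (hGp.comp fun y => ‖y‖ₑ ^ p).setLIntegral_comp_add (t • a)]
    _ = _ := by rw [lintegral_const, hν, mul_one]

/-- The Poincaré inequality on the cell. -/
theorem exists_poincare_const (x₀ : Eu N) (v : Module.Basis (Fin N) ℝ (Eu N))
    (hpq : p.HolderConjugate q) : ∃ C : ENNReal, C ≠ ⊤ ∧ ∀ (φ : Eu N → ℝ) (G : Eu N → Eu N),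
      IsPeriodicSobolev x₀ v p φ G → eLpNorm φ (ENNReal.ofReal p) (volume.restrict (cell x₀ v)) ≤
        C * eLpNorm G (ENNReal.ofReal p) (volume.restrict (cell x₀ v)) := by
  have hp0 := hpq.pos
  obtain ⟨R, hR⟩ := (isBounded_cell x₀ v).exists_norm_le
  set V := volume (cell x₀ v) with hV
  have hV0 : V ≠ 0 := volume_cell_ne_zero x₀ v
  have hVt : V ≠ ⊤ := volume_cell_ne_top x₀ v
  -- V^(p/q) comes from Jensen, R^p from |a| ≤ R for increments a in the cell, V from integrating
  -- over a, and V^(-p) from the final division.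
  set D : ENNReal := V ^ (-p) * (V ^ (p / q) * (ENNReal.ofReal R ^ p * V)) with hD
  have hDt : D ≠ ⊤ := by
    refine ENNReal.mul_ne_top (ENNReal.rpow_ne_top_of_ne_zero hV0 hVt) (ENNReal.mul_ne_top ?_
      (ENNReal.mul_ne_top ?_ hVt))
    · exact ENNReal.rpow_ne_top_of_ne_zero hV0 hVt
    · exact ENNReal.rpow_ne_top_of_nonneg hp0.le ENNReal.ofReal_ne_top
  refine ⟨D ^ (1 / p), ENNReal.rpow_ne_top_of_nonneg (by positivity) hDt, fun φ₀ G₀ h₀ => ?_⟩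
  obtain ⟨φ, G, m1, m2, p1, p2, e1, e2, h⟩ := h₀.exists_representative
  rw [eLpNorm_congr_ae (ae_restrict_of_ae e1), eLpNorm_congr_ae (ae_restrict_of_ae e2),
    eLpNorm_eq_lintegral_rpow_enorm_toReal (by simpa using hp0) (by simp),
    eLpNorm_eq_lintegral_rpow_enorm_toReal (by simpa using hp0) (by simp),
    ENNReal.toReal_ofReal hp0.le, ← ENNReal.mul_rpow_of_nonneg _ _ (by positivity)]
  refine ENNReal.rpow_le_rpow ?_ (by positivity)
  set I := ∫⁻ x in cell x₀ v, ‖G x‖ₑ ^ p with hI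
  have hm : Measurable fun z : Eu N × Eu N => ‖φ (z.1 + z.2) - φ z.1‖ₑ :=
    ((m1.comp_measurable (measurable_fst.add measurable_snd)).sub
      (m1.comp_measurable measurable_fst)).enorm
  -- By periodicity and zero mean, ∫_Q φ(x + a) da = 0. So V φ(x) is minus the integral over a in Q
  -- of the increments φ(x + a) - φ(x), which the translation estimate controls.
  have hpt : ∀ x, (V * ‖φ x‖ₑ) ^ p ≤
      V ^ (p / q) * ∫⁻ a in cell x₀ v, ‖φ (x + a) - φ x‖ₑ ^ p := by
    intro x
    have hi : IntegrableOn (fun a => φ (x + a)) (cell x₀ v) volume := by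
      simp_rw [add_comm x]
      exact ((locallyIntegrable_comp_add h.weakGradient.locallyIntegrable x).integrableOn_isCompact
        (isBounded_cell x₀ v).isCompact_closure).mono_set subset_closure
    have h1 : ∫ a in cell x₀ v, (φ (x + a) - φ x) = -(V.toReal * φ x) := by
      rw [integral_sub hi (integrable_const _)]
      simp_rw [add_comm x]
      rw [p1.setIntegral_comp_add x, h.integral_eq_zero, integral_const, zero_sub]
      simp [hV, Measure.real]
    have h2 : V * ‖φ x‖ₑ ≤ ∫⁻ a in cell x₀ v, ‖φ (x + a) - φ x‖ₑ := by
      have h3 := enorm_integral_le_lintegral_enorm (μ := volume.restrict (cell x₀ v))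
        fun a => φ (x + a) - φ x
      rw [h1, enorm_neg, enorm_mul, Real.enorm_eq_ofReal ENNReal.toReal_nonneg,
        ENNReal.ofReal_toReal hVt] at h3
      exact h3
    refine (ENNReal.rpow_le_rpow h2 hp0.le).trans ?_
    have h4 := lintegral_rpow_le_rpow (μ := volume.restrict (cell x₀ v)) hpq
      (f := fun a => ‖φ (x + a) - φ x‖ₑ) (hm.comp measurable_prodMk_left).aemeasurable
    rwa [Measure.restrict_apply_univ] at h4
  have hsum : V ^ p * ∫⁻ x in cell x₀ v, ‖φ x‖ₑ ^ p ≤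
      V ^ (p / q) * (ENNReal.ofReal R ^ p * V) * I := by
    calc V ^ p * ∫⁻ x in cell x₀ v, ‖φ x‖ₑ ^ p
        = ∫⁻ x in cell x₀ v, (V * ‖φ x‖ₑ) ^ p := by
          simp_rw [ENNReal.mul_rpow_of_nonneg _ _ hp0.le]
          rw [lintegral_const_mul _ (m1.enorm.pow_const p)]
      _ ≤ ∫⁻ x in cell x₀ v, V ^ (p / q) * ∫⁻ a in cell x₀ v, ‖φ (x + a) - φ x‖ₑ ^ p :=
          lintegral_mono hpt
      _ = V ^ (p / q) * ∫⁻ x in cell x₀ v, ∫⁻ a in cell x₀ v, ‖φ (x + a) - φ x‖ₑ ^ p :=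
          lintegral_const_mul _ (hm.pow_const p).lintegral_prod_right'
      _ = V ^ (p / q) * ∫⁻ a in cell x₀ v, ∫⁻ x in cell x₀ v, ‖φ (x + a) - φ x‖ₑ ^ p := by
          rw [lintegral_lintegral_swap (hm.pow_const p).aemeasurable]
      _ ≤ V ^ (p / q) * ∫⁻ a in cell x₀ v, ENNReal.ofReal R ^ p * I := by
          gcongr 1
          refine setLIntegral_mono measurable_const fun a ha => ?_
          refine (h.lintegral_translation_le hpq m2 p2 a).trans ?_
          gcongr
          rw [← ofReal_norm]
          exact ENNReal.ofReal_le_ofReal (hR a ha)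
      _ = _ := by
          rw [lintegral_const, Measure.restrict_apply_univ]
          ring
  calc ∫⁻ x in cell x₀ v, ‖φ x‖ₑ ^ p
      = V ^ (-p) * (V ^ p * ∫⁻ x in cell x₀ v, ‖φ x‖ₑ ^ p) := by
        rw [← mul_assoc, ← ENNReal.rpow_add _ _ hV0 hVt, neg_add_cancel, ENNReal.rpow_zero, one_mul]
    _ ≤ V ^ (-p) * (V ^ (p / q) * (ENNReal.ofReal R ^ p * V) * I) := by gcongr
    _ = D * I := by rw [hD]; ring

end Sobolev

/-! ### The space of periodic gradients -/

section Gradients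

variable {N : ℕ} {x₀ : Eu N} {v : Module.Basis (Fin N) ℝ (Eu N)} {p q : ℝ}

/-- Hölder's inequality on the cell, which has finite measure. -/
lemma eLpNorm_one_le_mul (hp : 1 < p) {F : Type*} [NormedAddCommGroup F]
    {f : Eu N → F} (hf : AEStronglyMeasurable f (volume.restrict (cell x₀ v))) :
    ∫⁻ x in cell x₀ v, ‖f x‖ₑ ≤
      eLpNorm f (ENNReal.ofReal p) (volume.restrict (cell x₀ v)) *
        volume (cell x₀ v) ^ (1 - 1 / p) := by
  have h := eLpNorm_le_eLpNorm_mul_rpow_measure_univ (p := 1) (q := ENNReal.ofReal p)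
    (by simpa using hp.le) hf
  rw [eLpNorm_one_eq_lintegral_enorm, Measure.restrict_apply_univ,
    ENNReal.toReal_ofReal (by linarith)] at h
  simpa using h

lemma volume_cell_rpow_ne_top (s : ℝ) : volume (cell x₀ v) ^ s ≠ ⊤ :=
  ENNReal.rpow_ne_top_of_ne_zero (volume_cell_ne_zero x₀ v) (volume_cell_ne_top x₀ v)

lemma locallyIntegrable_of_periodic (hp : 1 < p) {F : Type*} [NormedAddCommGroup F] {f : Eu N → F}
    (hf : AEStronglyMeasurable f volume) (hper : IsPeriodic v f)
    (hL : MemLp f (ENNReal.ofReal p) (volume.restrict (cell x₀ v))) :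
    LocallyIntegrable f volume := by
  rw [locallyIntegrable_iff]
  intro K hK
  obtain ⟨n, hn⟩ := exists_setLIntegral_le_of_isBounded x₀ v hK.isBounded hK.measurableSet
  refine ⟨hf.restrict, ?_⟩
  refine (hn _ (hper.comp fun y => ‖y‖ₑ)).trans_lt ?_
  refine ENNReal.mul_lt_top (ENNReal.natCast_lt_top n) ?_
  exact (eLpNorm_one_le_mul hp hf.restrict).trans_lt
    (ENNReal.mul_lt_top hL.2 (volume_cell_rpow_ne_top _).lt_top)

/-- Convergence in `L^p` of the cell implies convergence of periodic functions tested against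
compactly supported functions. -/
lemma tendsto_integral_mul_of_periodic (hp : 1 < p) {f : ℕ → Eu N → ℝ} {g : Eu N → ℝ}
    (hf : ∀ n, LocallyIntegrable (f n) volume) (hfp : ∀ n, IsPeriodic v (f n))
    (hg : LocallyIntegrable g volume) (hgp : IsPeriodic v g)
    (hlim : Tendsto (fun n => eLpNorm (fun x => f n x - g x) (ENNReal.ofReal p)
      (volume.restrict (cell x₀ v))) atTop (𝓝 0))
    {ψ : Eu N → ℝ} (hψ : Continuous ψ) (hs : HasCompactSupport ψ) :
    Tendsto (fun n => ∫ x, f n x * ψ x) atTop (𝓝 (∫ x, g x * ψ x)) := by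
  have hint : ∀ u : Eu N → ℝ, LocallyIntegrable u volume → Integrable fun x => u x * ψ x :=
    fun u hu => (hu.integrable_smul_left_of_hasCompactSupport hψ hs).congr
      (ae_of_all _ fun x => by simp [mul_comm])
  refine tendsto_integral_of_L1 _ (hint g hg).1 (Eventually.of_forall fun n => hint _ (hf n)) ?_
  obtain ⟨C, hC⟩ := hs.exists_bound_of_continuous hψ
  set K := tsupport ψ with hK
  have hKm : MeasurableSet K := (isClosed_tsupport ψ).measurableSet
  obtain ⟨n₀, hn₀⟩ := exists_setLIntegral_le_of_isBounded x₀ v hs.isCompact.isBounded hKm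
  set B : ENNReal := ENNReal.ofReal C * (n₀ * volume (cell x₀ v) ^ (1 - 1 / p)) with hB
  have hBt : B ≠ ⊤ := ENNReal.mul_ne_top ENNReal.ofReal_ne_top
    (ENNReal.mul_ne_top (ENNReal.natCast_ne_top _) (volume_cell_rpow_ne_top _))
  refine tendsto_of_tendsto_of_tendsto_of_le_of_le (h := fun n => B *
    eLpNorm (fun x => f n x - g x) (ENNReal.ofReal p) (volume.restrict (cell x₀ v)))
    tendsto_const_nhds ?_ (fun n => zero_le) fun n => ?_
  · have := ENNReal.Tendsto.const_mul (a := B) hlim (Or.inr hBt)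
    rwa [mul_zero] at this
  · have hper : IsPeriodic v fun x => ‖f n x - g x‖ₑ := fun x k hk => by
      simp only [hfp n x k hk, hgp x k hk]
    calc ∫⁻ x, ‖f n x * ψ x - g x * ψ x‖ₑ
        ≤ ∫⁻ x, K.indicator (fun x => ENNReal.ofReal C * ‖f n x - g x‖ₑ) x := by
          refine lintegral_mono fun x => ?_
          simp only
          rw [← sub_mul, enorm_mul, mul_comm]
          by_cases hx : x ∈ K
          · rw [Set.indicator_of_mem hx]
            gcongr
            rw [← ofReal_norm]
            exact ENNReal.ofReal_le_ofReal (hC x)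
          · rw [image_eq_zero_of_notMem_tsupport hx]
            simp
      _ = ENNReal.ofReal C * ∫⁻ x in K, ‖f n x - g x‖ₑ := by
          rw [lintegral_indicator hKm, lintegral_const_mul' _ _ ENNReal.ofReal_ne_top]
      _ ≤ ENNReal.ofReal C * (n₀ * (eLpNorm (fun x => f n x - g x) (ENNReal.ofReal p)
            (volume.restrict (cell x₀ v)) * volume (cell x₀ v) ^ (1 - 1 / p))) := by
          gcongr
          refine (hn₀ _ hper).trans ?_
          gcongr
          exact eLpNorm_one_le_mul hp
            ((hf n).aestronglyMeasurable.sub hg.aestronglyMeasurable).restrict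
      _ = _ := by rw [hB]; ring

/-- The gradients of functions in `W^{1,p}_#(Q)`, as a subspace of `L^p(Q)`. -/
def gradientSpace (x₀ : Eu N) (v : Module.Basis (Fin N) ℝ (Eu N)) (p : ℝ) :
    Submodule ℝ (Lp (Eu N) (ENNReal.ofReal p) (volume.restrict (cell x₀ v))) where
  carrier := {u | ∃ φ G, IsPeriodicSobolev x₀ v p φ G ∧ u =ᵐ[volume.restrict (cell x₀ v)] G}
  zero_mem' := ⟨_, _, isPeriodicSobolev_zero, Lp.coeFn_zero _ _ _⟩
  add_mem' := by
    rintro u u' ⟨φ, G, h, e⟩ ⟨φ', G', h', e'⟩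
    refine ⟨_, _, h.add h', ?_⟩
    filter_upwards [e, e', Lp.coeFn_add u u'] with x h1 h2 h3
    rw [h3, Pi.add_apply, h1, h2]
  smul_mem' := by
    rintro c u ⟨φ, G, h, e⟩
    refine ⟨_, _, h.const_smul c, ?_⟩
    filter_upwards [e, Lp.coeFn_smul c u] with x h1 h2
    rw [h2, Pi.smul_apply, h1]

lemma exists_periodic_extension {F : Type*} [NormedAddCommGroup F]
    {f : Eu N → F} (hf : StronglyMeasurable f) :
    ∃ g : Eu N → F, StronglyMeasurable g ∧ IsPeriodic v g ∧ ∀ x ∈ cell x₀ v, g x = f x :=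
  ⟨fun x => f (cellFract x₀ v x), hf.comp_measurable measurable_cellFract,
    isPeriodic_cellFract.comp _, fun x hx => by simp only [cellFract_of_mem_cell hx]⟩

/-- The limit of a sequence of functions and of gradients is a function and its gradient. -/
lemma IsPeriodicSobolev.of_tendsto (hp : 1 < p) {φ : ℕ → Eu N → ℝ} {G : ℕ → Eu N → Eu N}
    (h : ∀ n, IsPeriodicSobolev x₀ v p (φ n) (G n)) (hGp : ∀ n, IsPeriodic v (G n))
    {φ' : Eu N → ℝ} {G' : Eu N → Eu N} (mφ : StronglyMeasurable φ') (mG : StronglyMeasurable G')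
    (pφ : IsPeriodic v φ') (pG : IsPeriodic v G')
    (Lφ : MemLp φ' (ENNReal.ofReal p) (volume.restrict (cell x₀ v)))
    (LG : MemLp G' (ENNReal.ofReal p) (volume.restrict (cell x₀ v)))
    (limφ : Tendsto (fun n => eLpNorm (fun x => φ n x - φ' x) (ENNReal.ofReal p)
      (volume.restrict (cell x₀ v))) atTop (𝓝 0))
    (limG : Tendsto (fun n => eLpNorm (fun x => G n x - G' x) (ENNReal.ofReal p)
      (volume.restrict (cell x₀ v))) atTop (𝓝 0)) :
    IsPeriodicSobolev x₀ v p φ' G' := by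
  have iφ := locallyIntegrable_of_periodic hp mφ.aestronglyMeasurable pφ Lφ
  have iG := locallyIntegrable_of_periodic hp mG.aestronglyMeasurable pG LG
  refine ⟨fun x i => pφ x _ (basis_mem_lattice v i), ⟨iφ, iG, fun θ hθ hs w => ?_⟩, Lφ, LG, ?_⟩
  · have hdc : Continuous fun x => fderiv ℝ θ x w :=
      (hθ.continuous_fderiv (by simp)).clm_apply continuous_const
    have hds : HasCompactSupport fun x => fderiv ℝ θ x w :=
      (hs.fderiv ℝ).comp_left (g := fun L : Eu N →L[ℝ] ℝ => L w) (by simp)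
    have loc : ∀ g : Eu N → Eu N, LocallyIntegrable g volume →
        LocallyIntegrable (fun x => inner ℝ (g x) w) volume := fun g hg => by
      rw [locallyIntegrable_iff] at hg ⊢
      exact fun K hK => Integrable.inner_const (hg K hK) w
    have l1 := tendsto_integral_mul_of_periodic hp (fun n => (h n).weakGradient.locallyIntegrable)
      (fun n => (h n).isPeriodic) iφ pφ limφ hdc hds
    have limw : Tendsto (fun n => eLpNorm (fun x => inner ℝ (G n x) w - inner ℝ (G' x) w)
        (ENNReal.ofReal p) (volume.restrict (cell x₀ v))) atTop (𝓝 0) := by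
      have h0 := ENNReal.Tendsto.const_mul (a := ENNReal.ofReal ‖w‖) limG
        (Or.inr ENNReal.ofReal_ne_top)
      rw [mul_zero] at h0
      refine tendsto_of_tendsto_of_tendsto_of_le_of_le tendsto_const_nhds h0 (fun n => zero_le)
        fun n => eLpNorm_le_mul_eLpNorm_of_ae_le_mul (ae_of_all _ fun x => ?_) _
      rw [← inner_sub_left, mul_comm]
      exact norm_inner_le_norm _ _
    have l2 := tendsto_integral_mul_of_periodic hp
      (fun n => loc _ (h n).weakGradient.locallyIntegrable_grad)
      (fun n => (hGp n).comp fun y => inner ℝ y w) (loc _ iG) (pG.comp fun y => inner ℝ y w)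
      limw hθ.continuous hs
    refine tendsto_nhds_unique l1 (l2.neg.congr fun n => ?_)
    exact ((h n).weakGradient.integral_eq θ hθ hs w).symm
  · have h1 : Tendsto (fun n => ∫ x in cell x₀ v, φ n x) atTop (𝓝 (∫ x in cell x₀ v, φ' x)) := by
      refine tendsto_integral_of_L1 _ Lφ.1 (Eventually.of_forall fun n => (h n).integrableOn) ?_
      have h0 := ENNReal.Tendsto.mul_const (b := volume (cell x₀ v) ^ (1 - 1 / p)) limφ
        (Or.inr (volume_cell_rpow_ne_top _))
      rw [zero_mul] at h0
      exact tendsto_of_tendsto_of_tendsto_of_le_of_le tendsto_const_nhds h0 (fun n => zero_le)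
        fun n => eLpNorm_one_le_mul hp ((h n).memLp.1.sub Lφ.1)
    simp_rw [(h _).integral_eq_zero] at h1
    exact tendsto_nhds_unique h1 tendsto_const_nhds

/-- By Poincaré, mean-zero potentials of a convergent sequence of gradients are Cauchy in L^p, and
the weak gradient identity passes to the limit. Closedness is what allows a nongradient to be
separated from the gradients. -/
theorem isClosed_gradientSpace (hpq : p.HolderConjugate q) [Fact (1 ≤ ENNReal.ofReal p)] :
    IsClosed (gradientSpace x₀ v p :
      Set (Lp (Eu N) (ENNReal.ofReal p) (volume.restrict (cell x₀ v)))) := by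
  have hp := hpq.lt
  refine IsSeqClosed.isClosed fun u u' hu hlim => ?_
  choose φ₀ G₀ h₀ e₀ using hu
  choose φ G mφ mG pφ pG eφ eG h using fun n => (h₀ n).exists_representative
  have eu : ∀ n, u n =ᵐ[volume.restrict (cell x₀ v)] G n := fun n =>
    (e₀ n).trans (ae_restrict_of_ae (eG n))
  obtain ⟨C, hCt, hC⟩ := exists_poincare_const x₀ v hpq
  set a : ℕ → Lp ℝ (ENNReal.ofReal p) (volume.restrict (cell x₀ v)) := fun n =>
    (h n).memLp.toLp (φ n) with ha
  have hd : ∀ n m, dist (a n) (a m) ≤ C.toReal * dist (u n) (u m) := by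
    intro n m
    have e1 : eLpNorm (⇑(a n) - ⇑(a m)) (ENNReal.ofReal p) (volume.restrict (cell x₀ v)) =
        eLpNorm (fun x => φ n x - φ m x) (ENNReal.ofReal p) (volume.restrict (cell x₀ v)) := by
      refine eLpNorm_congr_ae ?_
      filter_upwards [(h n).memLp.coeFn_toLp, (h m).memLp.coeFn_toLp] with x h1 h2
      rw [Pi.sub_apply, ← h1, ← h2]
    have e2 : eLpNorm (⇑(u n) - ⇑(u m)) (ENNReal.ofReal p) (volume.restrict (cell x₀ v)) =
        eLpNorm (fun x => G n x - G m x) (ENNReal.ofReal p) (volume.restrict (cell x₀ v)) := by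
      refine eLpNorm_congr_ae ?_
      filter_upwards [eu n, eu m] with x h1 h2
      rw [Pi.sub_apply, h1, h2]
    rw [Lp.dist_def, Lp.dist_def, e1, e2, ← ENNReal.toReal_mul]
    refine ENNReal.toReal_mono (ENNReal.mul_ne_top hCt ?_) (hC _ _ ((h n).sub (h m)))
    exact ((h n).memLp_grad.sub (h m).memLp_grad).2.ne
  have hcau : CauchySeq a := by
    rw [Metric.cauchySeq_iff]
    intro ε hε
    have hC1 : 0 < C.toReal + 1 := by positivity
    obtain ⟨n₀, hn₀⟩ := Metric.cauchySeq_iff.1 hlim.cauchySeq (ε / (C.toReal + 1)) (by positivity)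
    refine ⟨n₀, fun n hn m hm => (hd n m).trans_lt ?_⟩
    have h1 := hn₀ n hn m hm
    rw [lt_div_iff₀ hC1] at h1
    have : 0 ≤ dist (u n) (u m) := dist_nonneg
    nlinarith
  obtain ⟨a', ha'⟩ := cauchySeq_tendsto_of_complete hcau
  -- The limits are known on the cell only, whereas weak gradients are tested on the whole space;
  -- hence the periodic extensions.
  obtain ⟨φ', mφ', pφ', eφ'⟩ := exists_periodic_extension (x₀ := x₀) (v := v)
    (Lp.stronglyMeasurable a')
  obtain ⟨G', mG', pG', eG'⟩ := exists_periodic_extension (x₀ := x₀) (v := v)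
    (Lp.stronglyMeasurable u')
  have fφ : a' =ᵐ[volume.restrict (cell x₀ v)] φ' := by
    filter_upwards [ae_restrict_mem (measurableSet_cell x₀ v)] with x hx using (eφ' x hx).symm
  have fG : u' =ᵐ[volume.restrict (cell x₀ v)] G' := by
    filter_upwards [ae_restrict_mem (measurableSet_cell x₀ v)] with x hx using (eG' x hx).symm
  refine ⟨φ', G', .of_tendsto hp h pG mφ' mG' pφ' pG' ((Lp.memLp a').ae_eq fφ)
    ((Lp.memLp u').ae_eq fG) ?_ ?_, fG⟩
  · refine ((Lp.tendsto_Lp_iff_tendsto_eLpNorm' _ _).1 ha').congr fun n => eLpNorm_congr_ae ?_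
    filter_upwards [(h n).memLp.coeFn_toLp, fφ] with x h1 h2
    rw [Pi.sub_apply, h1, h2]
  · refine ((Lp.tendsto_Lp_iff_tendsto_eLpNorm' _ _).1 hlim).congr fun n => eLpNorm_congr_ae ?_
    filter_upwards [eu n, fG] with x h1 h2
    rw [Pi.sub_apply, h1, h2]

/-- A field in `L^p(Q)` which is orthogonal to `L^q_#(Q)` is the gradient of a function in
`W^{1,p}_#(Q)`. -/
theorem exists_isPeriodicSobolev_of_orthogonal (hpq : p.HolderConjugate q) {u : Eu N → Eu N}
    (hu : MemLp u (ENNReal.ofReal p) (volume.restrict (cell x₀ v)))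
    (h : ∀ g, IsPeriodicDivFree x₀ v p q g → ∫ x in cell x₀ v, inner ℝ (g x) (u x) = 0) :
    ∃ φ G, IsPeriodicSobolev x₀ v p φ G ∧ u =ᵐ[volume.restrict (cell x₀ v)] G := by
  have : Fact (1 ≤ ENNReal.ofReal p) := ⟨by simpa using hpq.lt.le⟩
  suffices hmem : hu.toLp u ∈ gradientSpace x₀ v p by
    obtain ⟨φ, G, hG, e⟩ := hmem
    exact ⟨φ, G, hG, hu.coeFn_toLp.symm.trans e⟩
  by_contra hmem
  -- A form separating `u` from the closed subspace of gradients vanishes on that subspace, so its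
  -- Riesz density belongs to L^q_#. By hypothesis it then annihilates `u`, a contradiction.
  obtain ⟨f, s, hf1, hf2⟩ := geometric_hahn_banach_closed_point
    (gradientSpace x₀ v p).convex (isClosed_gradientSpace hpq) hmem
  have hs : 0 < s := by simpa using hf1 0 (gradientSpace x₀ v p).zero_mem
  have hf0 : ∀ y ∈ gradientSpace x₀ v p, f y = 0 := by
    intro y hy
    by_contra hne
    have h1 := hf1 (((s + 1) / f y) • y) ((gradientSpace x₀ v p).smul_mem _ hy)
    rw [map_smul, smul_eq_mul, div_mul_cancel₀ _ hne] at h1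
    linarith
  obtain ⟨g, hg, hgr⟩ := exists_lp_dual hpq f
  have hgd : IsPeriodicDivFree x₀ v p q g := by
    refine ⟨hg, fun φ G hG => ?_⟩
    have h1 := hf0 (hG.memLp_grad.toLp G) ⟨φ, G, hG, hG.memLp_grad.coeFn_toLp⟩
    rw [hgr] at h1
    rw [← h1]
    refine integral_congr_ae ?_
    filter_upwards [hG.memLp_grad.coeFn_toLp] with x hx
    rw [hx]
  have h2 := h g hgd
  have h3 : f (hu.toLp u) = ∫ x in cell x₀ v, inner ℝ (g x) (u x) := by
    rw [hgr]
    refine integral_congr_ae ?_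
    filter_upwards [hu.coeFn_toLp] with x hx
    rw [hx]
  rw [h3, h2] at hf2
  linarith

end Gradients

/-! ### Minima of convex families in duality -/

section Duality

variable {N : ℕ} {E : Eu N → Eu N → Set ℝ}

/-- If the sets `E ξ η` satisfy weak and strong selfduality, their infima are supremal values of
the dual problem. -/
lemma isLeast_and_isLUB_of_duality (hne : ∀ ξ η, (E ξ η).Nonempty)
    (hweak : ∀ a b ξ η : Eu N, ∀ r ∈ E a b, ∀ s ∈ E ξ η, inner ℝ b ξ + inner ℝ a η - s ≤ r)
    (hstrong : ∀ (a b : Eu N) (m : ℝ),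
      (∀ ξ η : Eu N, ∀ s ∈ E ξ η, inner ℝ b ξ + inner ℝ a η - s ≤ m) → ∃ r ∈ E a b, r ≤ m)
    (a b : Eu N) :
    IsLeast (E a b) (sInf (E a b)) ∧
      IsLUB {t : ℝ | ∃ ξ η : Eu N, ∃ s ∈ E ξ η, t = inner ℝ b ξ + inner ℝ a η - s}
        (sInf (E a b)) := by
  set T := {t : ℝ | ∃ ξ η : Eu N, ∃ s ∈ E ξ η, t = inner ℝ b ξ + inner ℝ a η - s} with hT
  have hub : ∀ r ∈ E a b, r ∈ upperBounds T := by
    rintro r hr t ⟨ξ, η, s, hs, rfl⟩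
    exact hweak a b ξ η r hr s hs
  have hTne : T.Nonempty := by
    obtain ⟨s, hs⟩ := hne 0 0
    exact ⟨_, 0, 0, s, hs, rfl⟩
  obtain ⟨r₀, hr₀⟩ := hne a b
  have hlub : IsLUB T (sSup T) := isLUB_csSup hTne ⟨r₀, hub r₀ hr₀⟩
  -- The dual value is the smallest admissible `m`. Strong duality there yields an element of `E a
  -- b` that reaches it, giving attainment and absence of a gap together.
  obtain ⟨r, hr, hrm⟩ := hstrong a b (sSup T) fun ξ η s hs => hlub.1 ⟨ξ, η, s, hs, rfl⟩
  have hle : ∀ r' ∈ E a b, sSup T ≤ r' := fun r' hr' => hlub.2 (hub r' hr')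
  have hrT : r = sSup T := le_antisymm hrm (hle r hr)
  have hleast : IsLeast (E a b) r := ⟨hr, fun r' hr' => by rw [hrT]; exact hle r' hr'⟩
  rw [hleast.csInf_eq]
  exact ⟨hleast, by rw [hrT]; exact hlub⟩

/-- By duality the infimum is also a supremum of continuous affine functions of (a, b), hence convex
and lower semicontinuous. That same supremum, after minimizing over s for fixed (ξ, η), is the
Fenchel dual. -/
lemma isSelfdualLagrangian_sInf_of_duality (hne : ∀ ξ η, (E ξ η).Nonempty)
    (hweak : ∀ a b ξ η : Eu N, ∀ r ∈ E a b, ∀ s ∈ E ξ η, inner ℝ b ξ + inner ℝ a η - s ≤ r)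
    (hstrong : ∀ (a b : Eu N) (m : ℝ),
      (∀ ξ η : Eu N, ∀ s ∈ E ξ η, inner ℝ b ξ + inner ℝ a η - s ≤ m) → ∃ r ∈ E a b, r ≤ m) :
    IsSelfdualLagrangian fun ξ η => sInf (E ξ η) := by
  have hleast := fun a b => (isLeast_and_isLUB_of_duality hne hweak hstrong a b).1
  have hlub := fun a b => (isLeast_and_isLUB_of_duality hne hweak hstrong a b).2
  have hle : ∀ a b ξ η : Eu N, ∀ s ∈ E ξ η, inner ℝ b ξ + inner ℝ a η - s ≤ sInf (E a b) :=
    fun a b ξ η s hs => (hlub a b).1 ⟨ξ, η, s, hs, rfl⟩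
  refine ⟨⟨convex_univ, ?_⟩, ?_, fun a b => ?_⟩
  · rintro z _ w _ α γ hα hγ hαγ
    refine (hlub _ _).2 ?_
    rintro _ ⟨ξ, η, s, hs, rfl⟩
    have h1 := mul_le_mul_of_nonneg_left (hle z.1 z.2 ξ η s hs) hα
    have h2 := mul_le_mul_of_nonneg_left (hle w.1 w.2 ξ η s hs) hγ
    simp only [Prod.snd_add, Prod.fst_add, Prod.smul_fst, Prod.smul_snd, inner_add_left,
      inner_smul_left, RCLike.conj_to_real, smul_eq_mul]
    have h3 : s = α * s + γ * s := by rw [← add_mul, hαγ, one_mul]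
    linarith
  · intro z y hy
    obtain ⟨_, ⟨ξ, η, s, hs, rfl⟩, h1, -⟩ := (hlub z.1 z.2).exists_between hy
    have hc : Continuous fun z : Eu N × Eu N => inner ℝ z.2 ξ + inner ℝ z.1 η - s := by fun_prop
    filter_upwards [hc.continuousAt.eventually (lt_mem_nhds h1)] with w hw
    exact hw.trans_le (hle _ _ _ _ s hs)
  · apply le_antisymm
    · refine iSup_le fun z => ?_
      rw [EReal.coe_le_coe_iff]
      exact hle _ _ _ _ _ (hleast _ _).1
    · have hmem : ∀ ξ η : Eu N, ((inner ℝ b ξ + inner ℝ a η - sInf (E ξ η) : ℝ) : EReal) ≤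
          fenchelDual (fun ξ η => sInf (E ξ η)) b a := fun ξ η =>
        le_iSup (fun z : Eu N × Eu N =>
          ((inner ℝ b z.1 + inner ℝ a z.2 - sInf (E z.1 z.2) : ℝ) : EReal)) (ξ, η)
      -- The dual is treated as an arbitrary extended real upper bound: ⊥ is impossible, ⊤ is
      -- trivial, and a finite value bounds the whole dual family.
      generalize fenchelDual (fun ξ η => sInf (E ξ η)) b a = S at hmem
      induction S using EReal.rec with
      | bot => exact absurd (hmem 0 0) (by simp)
      | top => exact le_top
      | coe S =>
        rw [EReal.coe_le_coe_iff]
        refine (hlub a b).2 ?_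
        rintro _ ⟨ξ, η, s, hs, rfl⟩
        have h1 := EReal.coe_le_coe_iff.1 (hmem ξ η)
        have h2 := (hleast ξ η).2 hs
        linarith

end Duality

/-! ### The cell problem -/

section CellProblem

variable {N : ℕ} {x₀ : Eu N} {v : Module.Basis (Fin N) ℝ (Eu N)} {p q : ℝ}
  {L : Eu N → Eu N → Eu N → ℝ}

/-- The point is superposition measurability: for Borel fields, x ↦ (x, u x, w x) is measurable from
the Lebesgue to the product σ-algebra; general fields are replaced by Borel representatives. -/
lemma isSelfdualIntegrand_cell {Ω : Set (Eu N)} (hQ : cell x₀ v ⊆ Ω)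
    (hL : IsSelfdualLagrangianOn Ω L) (hg : HasGrowth Ω p q L) :
    IsSelfdualIntegrand (volume.restrict (cell x₀ v)) p q L where
  aestronglyMeasurable := by
    intro u w hu hw
    have hmeas : ∀ u w : Eu N → Eu N, Measurable u → Measurable w →
        AEStronglyMeasurable (fun x => L x (u x) (w x)) (volume.restrict (cell x₀ v)) := by
      intro u w hu hw
      refine (NullMeasurable.aemeasurable fun B hB => ?_).aestronglyMeasurable
      have h1 := hL.measurable B hB
      -- The identity, from the Lebesgue to the Borel σ-algebra.
      let ι : NullMeasurableSpace (Eu N) volume → Eu N := fun x => x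
      have hid : Measurable ι := fun s hs => MeasurableSet.nullMeasurableSet hs
      have hm : Measurable (fun x : NullMeasurableSpace (Eu N) volume =>
          ((x, (u x, w x)) : NullMeasurableSpace (Eu N) volume × (Eu N × Eu N))) :=
        measurable_id.prodMk ((hu.comp hid).prodMk (hw.comp hid))
      have h2 : NullMeasurableSet {x : Eu N | x ∈ Ω ∧ L x (u x) (w x) ∈ B} volume := hm h1
      refine (h2.mono_ac Measure.restrict_le_self.absolutelyContinuous).congr ?_
      filter_upwards [ae_restrict_mem (measurableSet_cell x₀ v)] with x hx
      exact propext ⟨fun h => h.2, fun h => ⟨hQ hx, h⟩⟩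
    refine (hmeas _ _ hu.stronglyMeasurable_mk.measurable
      hw.stronglyMeasurable_mk.measurable).congr ?_
    filter_upwards [hu.ae_eq_mk, hw.ae_eq_mk] with x h1 h2
    rw [← h1, ← h2]
  selfdual := by
    filter_upwards [ae_restrict_mem (measurableSet_cell x₀ v)] with x hx
    exact hL.selfdual x (hQ hx)
  growth := by
    obtain ⟨C₀, C₁, hC₀, hC₁, n₀, n₁, h₀, h₁, h⟩ := hg
    exact ⟨C₀, C₁, hC₀, hC₁, n₀, n₁, h₀.mono_set hQ, h₁.mono_set hQ,
      ae_restrict_of_ae_restrict_of_subset hQ h⟩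

lemma integrable_of_memLp_cell {F : Type*} [NormedAddCommGroup F] {s : ℝ} (hs : 1 < s)
    {f : Eu N → F} (hf : MemLp f (ENNReal.ofReal s) (volume.restrict (cell x₀ v))) :
    IntegrableOn f (cell x₀ v) volume :=
  hf.integrable (by simpa using hs.le)

namespace IsPeriodicDivFree

variable {g g' : Eu N → Eu N}

lemma zero : IsPeriodicDivFree x₀ v p q (fun _ => 0) := ⟨MemLp.zero, fun _ _ _ => by simp⟩

/-- Constants are orthogonal to periodic gradients because the latter have mean zero. -/
lemma const (η : Eu N) : IsPeriodicDivFree x₀ v p q (fun _ => η) := by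
  refine ⟨memLp_const η, fun φ G h => ?_⟩
  have hi : IntegrableOn G (cell x₀ v) volume :=
    (h.weakGradient.locallyIntegrable_grad.integrableOn_isCompact
      (isBounded_cell x₀ v).isCompact_closure).mono_set subset_closure
  rw [integral_inner hi, h.integral_grad_eq_zero, inner_zero_right]

lemma add (hpq : p.HolderConjugate q) (h : IsPeriodicDivFree x₀ v p q g)
    (h' : IsPeriodicDivFree x₀ v p q g') : IsPeriodicDivFree x₀ v p q fun x => g x + g' x := by
  refine ⟨h.memLp.add h'.memLp, fun φ G hG => ?_⟩
  simp_rw [inner_add_left]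
  rw [integral_add (integrable_inner_of_conj hpq.symm h.memLp hG.memLp_grad)
    (integrable_inner_of_conj hpq.symm h'.memLp hG.memLp_grad), h.orthogonal φ G hG,
    h'.orthogonal φ G hG, add_zero]

lemma const_smul (h : IsPeriodicDivFree x₀ v p q g) (c : ℝ) :
    IsPeriodicDivFree x₀ v p q fun x => c • g x := by
  refine ⟨h.memLp.const_smul c, fun φ G hG => ?_⟩
  simp_rw [inner_smul_left]
  rw [integral_const_mul, h.orthogonal φ G hG, mul_zero]

end IsPeriodicDivFree

lemma memLp_const_add {s : ℝ} (ξ : Eu N) {G : Eu N → Eu N}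
    (hG : MemLp G (ENNReal.ofReal s) (volume.restrict (cell x₀ v))) :
    MemLp (fun x => ξ + G x) (ENNReal.ofReal s) (volume.restrict (cell x₀ v)) :=
  (memLp_const ξ).add hG

/-- Pairing of `ξ + ∇φ` with a divergence free field. -/
lemma IsPeriodicDivFree.integral_inner_add (hpq : p.HolderConjugate q) {g : Eu N → Eu N}
    (hg : IsPeriodicDivFree x₀ v p q g) {φ : Eu N → ℝ} {G : Eu N → Eu N}
    (hG : IsPeriodicSobolev x₀ v p φ G) (ξ : Eu N) :
    ∫ x in cell x₀ v, inner ℝ (g x) (ξ + G x) = inner ℝ (∫ x in cell x₀ v, g x) ξ := by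
  have hi := integrable_of_memLp_cell hpq.symm.lt hg.memLp
  simp_rw [inner_add_right]
  rw [integral_add (hi.inner_const ξ) (integrable_inner_of_conj hpq.symm hg.memLp hG.memLp_grad),
    hg.orthogonal φ G hG, add_zero]
  simp_rw [real_inner_comm ξ]
  rw [integral_inner hi]

/-- The admissible pairs of fields: gradients up to constants, and divergence free fields. -/
def admissiblePairs (x₀ : Eu N) (v : Module.Basis (Fin N) ℝ (Eu N)) (hpq : p.HolderConjugate q) :
    Submodule ℝ (Lp (Eu N) (ENNReal.ofReal p) (volume.restrict (cell x₀ v)) ×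
      Lp (Eu N) (ENNReal.ofReal q) (volume.restrict (cell x₀ v))) where
  carrier := {z | ∃ ξ φ G g, IsPeriodicSobolev x₀ v p φ G ∧ IsPeriodicDivFree x₀ v p q g ∧
    z.1 =ᵐ[volume.restrict (cell x₀ v)] (fun x => ξ + G x) ∧
    z.2 =ᵐ[volume.restrict (cell x₀ v)] g}
  zero_mem' := ⟨0, _, _, _, isPeriodicSobolev_zero, .zero, by
    filter_upwards [Lp.coeFn_zero (Eu N) (ENNReal.ofReal p) (volume.restrict (cell x₀ v))] with x hx
    rw [Prod.fst_zero, hx, Pi.zero_apply, add_zero], Lp.coeFn_zero _ _ _⟩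
  add_mem' := by
    rintro z z' ⟨ξ, φ, G, g, h1, h2, h3, h4⟩ ⟨ξ', φ', G', g', h1', h2', h3', h4'⟩
    refine ⟨ξ + ξ', _, _, _, h1.add h1', h2.add hpq h2', ?_, ?_⟩
    · filter_upwards [h3, h3', Lp.coeFn_add z.1 z'.1] with x e1 e2 e3
      rw [Prod.fst_add, e3, Pi.add_apply, e1, e2]
      abel
    · filter_upwards [h4, h4', Lp.coeFn_add z.2 z'.2] with x e1 e2 e3
      rw [Prod.snd_add, e3, Pi.add_apply, e1, e2]
  smul_mem' := by
    rintro c z ⟨ξ, φ, G, g, h1, h2, h3, h4⟩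
    refine ⟨c • ξ, _, _, _, h1.const_smul c, h2.const_smul c, ?_, ?_⟩
    · filter_upwards [h3, Lp.coeFn_smul c z.1] with x e1 e2
      rw [Prod.smul_fst, e2, Pi.smul_apply, e1, smul_add]
    · filter_upwards [h4, Lp.coeFn_smul c z.2] with x e1 e2
      rw [Prod.smul_snd, e2, Pi.smul_apply, e1]

/-- The linear form given by integration against a constant vector. -/
lemma exists_clm_integral_inner_const {α : Type*} [MeasurableSpace α] {μ : Measure α}
    [IsFiniteMeasure μ] (hpq : p.HolderConjugate q) [Fact (1 ≤ ENNReal.ofReal p)] (b : Eu N) :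
    ∃ l : Lp (Eu N) (ENNReal.ofReal p) μ →L[ℝ] ℝ, ∀ u, l u = ∫ x, inner ℝ b (u x) ∂μ := by
  have : Fact (1 ≤ ENNReal.ofReal q) := ⟨by simpa using hpq.symm.lt.le⟩
  have := hpq.symm.ennrealOfReal
  refine ⟨(innerSL ℝ (E := Eu N)).lpPairing μ (ENNReal.ofReal q) (ENNReal.ofReal p)
    ((memLp_const b).toLp _), fun u => ?_⟩
  rw [ContinuousLinearMap.lpPairing_eq_integral]
  refine integral_congr_ae ?_
  filter_upwards [(memLp_const (μ := μ) (p := ENNReal.ofReal q) b).coeFn_toLp] with x hx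
  rw [hx]
  rfl

/-- Strong duality for the cell problem. -/
theorem exists_cell_pair_le (hpq : p.HolderConjugate q)
    (hL : IsSelfdualIntegrand (volume.restrict (cell x₀ v)) p q L) (a b : Eu N) (m : ℝ)
    (hm : ∀ (ξ : Eu N) (φ : Eu N → ℝ) (G g : Eu N → Eu N), IsPeriodicSobolev x₀ v p φ G →
      IsPeriodicDivFree x₀ v p q g →
      volume.real (cell x₀ v) * inner ℝ b ξ + inner ℝ a (∫ x in cell x₀ v, g x) ≤
        (∫ x in cell x₀ v, L x (ξ + G x) (g x)) + m) :
    ∃ (φ : Eu N → ℝ) (G g : Eu N → Eu N), IsPeriodicSobolev x₀ v p φ G ∧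
      IsPeriodicDivFree x₀ v p q g ∧ ∫ x in cell x₀ v, g x = 0 ∧
      ∫ x in cell x₀ v, L x (a + G x) (b + g x) ≤ m := by
  have : Fact (1 ≤ ENNReal.ofReal p) := ⟨by simpa using hpq.lt.le⟩
  have : Fact (1 ≤ ENNReal.ofReal q) := ⟨by simpa using hpq.symm.lt.le⟩
  obtain ⟨l₁, hl₁⟩ := exists_clm_integral_inner_const (μ := volume.restrict (cell x₀ v)) hpq b
  obtain ⟨l₂, hl₂⟩ := exists_clm_integral_inner_const (μ := volume.restrict (cell x₀ v)) hpq.symm a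
  set l := l₁.comp (ContinuousLinearMap.fst ℝ _ _) + l₂.comp (ContinuousLinearMap.snd ℝ _ _) with hl
  have hlz : ∀ z, l z = (∫ x in cell x₀ v, inner ℝ b (z.1 x)) +
      ∫ x in cell x₀ v, inner ℝ a (z.2 x) := fun z => by
    rw [← hl₁, ← hl₂]; rfl
  have hval : ∀ z : Lp (Eu N) (ENNReal.ofReal p) (volume.restrict (cell x₀ v)) ×
      Lp (Eu N) (ENNReal.ofReal q) (volume.restrict (cell x₀ v)), ∀ ξ φ G g,
      IsPeriodicSobolev x₀ v p φ G → IsPeriodicDivFree x₀ v p q g →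
      z.1 =ᵐ[volume.restrict (cell x₀ v)] (fun x => ξ + G x) →
      z.2 =ᵐ[volume.restrict (cell x₀ v)] g →
      l z = volume.real (cell x₀ v) * inner ℝ b ξ + inner ℝ a (∫ x in cell x₀ v, g x) := by
    intro z ξ φ G g hG hg e1 e2
    rw [hlz]
    congr 1
    · rw [integral_congr_ae (g := fun x => inner ℝ b (ξ + G x))
        (by filter_upwards [e1] with x hx; rw [hx]),
        (IsPeriodicDivFree.const b).integral_inner_add hpq hG, integral_const, inner_smul_left]
      simp
    · rw [integral_congr_ae (g := fun x => inner ℝ a (g x))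
        (by filter_upwards [e2] with x hx; rw [hx]),
        integral_inner (integrable_of_memLp_cell hpq.symm.lt hg.memLp)]
  -- On admissible pairs the form `l` sees only the means, so `hm` says exactly that `l` lies below
  -- the functional plus `m` there.
  obtain ⟨A, B, hA, hB, hAB, hle⟩ := hL.exists_dual_pair hpq (admissiblePairs x₀ v hpq) l m (by
    rintro z ⟨ξ, φ, G, g, hG, hg, e1, e2⟩
    rw [hval z ξ φ G g hG hg e1 e2]
    refine (hm ξ φ G g hG hg).trans (le_of_eq ?_)
    congr 1
    refine integral_congr_ae ?_
    filter_upwards [e1, e2] with x h1 h2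
    rw [h1, h2])
  have hrep : ∀ ξ φ G g, IsPeriodicSobolev x₀ v p φ G → IsPeriodicDivFree x₀ v p q g →
      (∫ x in cell x₀ v, inner ℝ (B x) (ξ + G x)) + ∫ x in cell x₀ v, inner ℝ (A x) (g x) =
        volume.real (cell x₀ v) * inner ℝ b ξ + inner ℝ a (∫ x in cell x₀ v, g x) := by
    intro ξ φ G g hG hg
    have m1 := memLp_const_add ξ hG.memLp_grad
    have h1 := hAB (m1.toLp _, hg.memLp.toLp _)
      ⟨ξ, φ, G, g, hG, hg, m1.coeFn_toLp, hg.memLp.coeFn_toLp⟩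
    rw [hval _ ξ φ G g hG hg m1.coeFn_toLp hg.memLp.coeFn_toLp] at h1
    rw [← h1]
    congr 1
    · refine integral_congr_ae ?_
      filter_upwards [m1.coeFn_toLp] with x hx
      rw [hx]
    · refine integral_congr_ae ?_
      filter_upwards [hg.memLp.coeFn_toLp] with x hx
      rw [hx]
  have hBi : IntegrableOn B (cell x₀ v) volume := integrable_of_memLp_cell hpq.symm.lt hB
  have hBb : MemLp (fun x => B x - b) (ENNReal.ofReal q) (volume.restrict (cell x₀ v)) :=
    hB.sub (memLp_const b)
  have hAa : MemLp (fun x => A x - a) (ENNReal.ofReal p) (volume.restrict (cell x₀ v)) :=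
    hA.sub (memLp_const a)
  -- The pairs (∇φ, 0) show that B, hence B - b, annihilates gradients.
  have hdiv : IsPeriodicDivFree x₀ v p q fun x => B x - b := by
    refine ⟨hBb, fun φ G hG => ?_⟩
    have h1 := hrep 0 φ G _ hG IsPeriodicDivFree.zero
    simp only [zero_add, inner_zero_right, integral_zero, add_zero, mul_zero] at h1
    simp_rw [inner_sub_left]
    rw [integral_sub (integrable_inner_of_conj hpq.symm hB hG.memLp_grad)
      (integrable_inner_of_conj hpq.symm (memLp_const b) hG.memLp_grad), h1,
      (IsPeriodicDivFree.const (p := p) (q := q) b).orthogonal φ G hG, sub_zero]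
  -- The constant pairs (w, 0) identify the mean of B as b.
  have hmean : ∫ x in cell x₀ v, (B x - b) = 0 := by
    refine ext_inner_left ℝ fun w => ?_
    have h1 := hrep w _ _ _ isPeriodicSobolev_zero IsPeriodicDivFree.zero
    simp only [inner_zero_right, integral_zero, add_zero] at h1
    rw [integral_sub hBi (integrable_const b), integral_const, inner_sub_right,
      ← integral_inner hBi, inner_zero_right, inner_smul_right, sub_eq_zero]
    simp_rw [real_inner_comm _ w]
    rw [h1]
    simp
  -- The pairs (0, g) show that A - a is orthogonal to L^q_#, hence a periodic gradient.
  obtain ⟨φ, G, hG, e⟩ := exists_isPeriodicSobolev_of_orthogonal hpq hAa fun g hg => by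
    have h1 := hrep 0 _ _ g isPeriodicSobolev_zero hg
    simp only [zero_add, inner_zero_right, integral_zero, mul_zero] at h1
    simp_rw [inner_sub_right]
    rw [integral_sub (integrable_inner_of_conj hpq.symm hg.memLp hA)
      (integrable_inner_of_conj hpq.symm hg.memLp (memLp_const a))]
    simp_rw [fun x => real_inner_comm (A x) (g x), fun x => real_inner_comm a (g x)]
    rw [h1, integral_inner (integrable_of_memLp_cell hpq.symm.lt hg.memLp), sub_self]
  refine ⟨φ, G, _, hG, hdiv, hmean, le_trans (le_of_eq ?_) hle⟩
  refine integral_congr_ae ?_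
  filter_upwards [e] with x hx
  rw [← hx]
  simp

/-- Weak duality for the cell problem. -/
lemma weak_duality_cell (hpq : p.HolderConjugate q)
    (hL : IsSelfdualIntegrand (volume.restrict (cell x₀ v)) p q L) {a ξ : Eu N}
    {φ φ' : Eu N → ℝ} {G G' w w' : Eu N → Eu N} (hG : IsPeriodicSobolev x₀ v p φ G)
    (hG' : IsPeriodicSobolev x₀ v p φ' G') (hw : IsPeriodicDivFree x₀ v p q w)
    (hw' : IsPeriodicDivFree x₀ v p q w') :
    inner ℝ (∫ x in cell x₀ v, w x) ξ + inner ℝ a (∫ x in cell x₀ v, w' x) ≤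
      (∫ x in cell x₀ v, L x (a + G x) (w x)) + ∫ x in cell x₀ v, L x (ξ + G' x) (w' x) := by
  have m1 := memLp_const_add a hG.memLp_grad
  have m2 := memLp_const_add ξ hG'.memLp_grad
  have i1 := hL.integrable hpq m1 hw.memLp
  have i2 := hL.integrable hpq m2 hw'.memLp
  have j1 := integrable_inner_of_conj hpq.symm hw.memLp m2
  have j2 := integrable_inner_of_conj hpq.symm hw'.memLp m1
  rw [← hw.integral_inner_add hpq hG' ξ, real_inner_comm, ← hw'.integral_inner_add hpq hG a,
    ← integral_add i1 i2, ← integral_add j1 j2]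
  refine integral_mono_ae (j1.add j2) (i1.add i2) ?_
  filter_upwards [hL.selfdual] with x hx
  have := hx.inner_add_inner_le (a + G x) (w x) (ξ + G' x) (w' x)
  rw [real_inner_comm (w' x)] at this
  exact this

lemma volume_real_cell_pos : 0 < volume.real (cell x₀ v) :=
  ENNReal.toReal_pos (volume_cell_ne_zero x₀ v) (volume_cell_ne_top x₀ v)

lemma IsPeriodicDivFree.const_add (hpq : p.HolderConjugate q) {g : Eu N → Eu N}
    (hg : IsPeriodicDivFree x₀ v p q g) (η : Eu N) :
    IsPeriodicDivFree x₀ v p q fun x => η + g x :=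
  (IsPeriodicDivFree.const η).add hpq hg

lemma IsPeriodicDivFree.integral_const_add (hpq : p.HolderConjugate q) {g : Eu N → Eu N}
    (hg : IsPeriodicDivFree x₀ v p q g) (η : Eu N) :
    ∫ x in cell x₀ v, (η + g x) = volume.real (cell x₀ v) • η + ∫ x in cell x₀ v, g x := by
  rw [integral_add (integrable_const η) (integrable_of_memLp_cell hpq.symm.lt hg.memLp),
    integral_const]
  simp

lemma cellEnergies_nonempty (ξ η : Eu N) : (cellEnergies x₀ v p q L ξ η).Nonempty :=
  ⟨_, _, _, _, isPeriodicSobolev_zero, .zero, by simp, rfl⟩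

/-- The fields b + g and η + g' have means b and η, so dividing weak duality by |Q| gives the claim.
-/
lemma cellEnergies_weak (hpq : p.HolderConjugate q)
    (hL : IsSelfdualIntegrand (volume.restrict (cell x₀ v)) p q L) (a b ξ η : Eu N) :
    ∀ r ∈ cellEnergies x₀ v p q L a b, ∀ s ∈ cellEnergies x₀ v p q L ξ η,
      inner ℝ b ξ + inner ℝ a η - s ≤ r := by
  rintro _ ⟨φ, G, g, hG, hg, h0, rfl⟩ _ ⟨φ', G', g', hG', hg', h0', rfl⟩
  have hV := volume_real_cell_pos (x₀ := x₀) (v := v)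
  have h := weak_duality_cell (a := a) (ξ := ξ) hpq hL hG hG' (hg.const_add hpq b)
    (hg'.const_add hpq η)
  rw [hg.integral_const_add hpq, hg'.integral_const_add hpq, h0, h0', add_zero, add_zero,
    inner_smul_left, inner_smul_right] at h
  rw [setAverage_eq, setAverage_eq, smul_eq_mul, smul_eq_mul, sub_le_iff_le_add, ← mul_add,
    ← div_eq_inv_mul, le_div_iff₀ hV]
  simp only [RCLike.conj_to_real] at h
  linarith

lemma cellEnergies_strong (hpq : p.HolderConjugate q)
    (hL : IsSelfdualIntegrand (volume.restrict (cell x₀ v)) p q L) (a b : Eu N) (m : ℝ)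
    (hm : ∀ ξ η : Eu N, ∀ s ∈ cellEnergies x₀ v p q L ξ η, inner ℝ b ξ + inner ℝ a η - s ≤ m) :
    ∃ r ∈ cellEnergies x₀ v p q L a b, r ≤ m := by
  have hV := volume_real_cell_pos (x₀ := x₀) (v := v)
  obtain ⟨φ, G, g, hG, hg, h0, hle⟩ := exists_cell_pair_le hpq hL a b
    (volume.real (cell x₀ v) * m) fun ξ φ G g hG hg => by
    -- An arbitrary element of L^q_# is its average plus a mean-zero element, so `hm` applies with η
    -- equal to that average.
    set η := ⨍ x in cell x₀ v, g x with hη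
    have hint : ∫ x in cell x₀ v, g x = volume.real (cell x₀ v) • η := by
      rw [hη, setAverage_eq, smul_inv_smul₀ hV.ne']
    have hg' := hg.const_add hpq (-η)
    have h1 := hm ξ η _ ⟨φ, G, _, hG, hg', by
      rw [hg.integral_const_add hpq, hint]; simp, rfl⟩
    simp only [add_neg_cancel_left] at h1
    rw [setAverage_eq, smul_eq_mul, sub_le_iff_le_add, ← div_eq_inv_mul] at h1
    rw [hint, inner_smul_right]
    have h2 := mul_le_mul_of_nonneg_left h1 hV.le
    rw [mul_add, mul_add, mul_div_cancel₀ _ hV.ne'] at h2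
    linarith
  refine ⟨_, ⟨φ, G, g, hG, hg, h0, rfl⟩, ?_⟩
  rw [setAverage_eq, smul_eq_mul, ← div_eq_inv_mul, div_le_iff₀ hV]
  linarith

/-- The homogenized operator is the vector field of the homogenized Lagrangian. -/
lemma betaHom_eq_selfdualField (hpq : p.HolderConjugate q)
    (hL : IsSelfdualIntegrand (volume.restrict (cell x₀ v)) p q L)
    (hmin : ∀ ξ η, IsLeast (cellEnergies x₀ v p q L ξ η) (LHom x₀ v p q L ξ η))
    (hsd : IsSelfdualLagrangian (LHom x₀ v p q L)) {β : Eu N → Eu N → Set (Eu N)}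
    (hβ : ∀ᵐ x ∂(volume.restrict (cell x₀ v)), ∀ ξ, β x ξ = selfdualField (L x) ξ) (ξ : Eu N) :
    betaHom x₀ v p q β ξ = selfdualField (LHom x₀ v p q L) ξ := by
  have hV := volume_real_cell_pos (x₀ := x₀) (v := v)
  have hpair : ∀ (φ : Eu N → ℝ) (G w : Eu N → Eu N), IsPeriodicSobolev x₀ v p φ G →
      IsPeriodicDivFree x₀ v p q w → ⨍ x in cell x₀ v, inner ℝ (ξ + G x) (w x) =
        inner ℝ ξ (⨍ x in cell x₀ v, w x) := by
    intro φ G w hG hw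
    have h1 := hw.integral_inner_add hpq hG ξ
    simp_rw [fun x => real_inner_comm (ξ + G x) (w x)] at h1
    rw [setAverage_eq, setAverage_eq, h1, inner_smul_right, real_inner_comm, smul_eq_mul]
  ext η
  constructor
  · rintro ⟨g, φ, G, hg, hG, hmem, rfl⟩
    set η := ⨍ x in cell x₀ v, g x with hη
    have hint : ∫ x in cell x₀ v, g x = volume.real (cell x₀ v) • η := by
      rw [hη, setAverage_eq, smul_inv_smul₀ hV.ne']
    -- The field g - η is a mean-zero competitor. Its energy is the average of ⟨ξ + ∇φ, g⟩, which is
    -- ⟨ξ, η⟩, the least value that L_hom(ξ, η) can take.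
    have h1 := (hmin ξ η).2 ⟨φ, G, _, hG, hg.const_add hpq (-η), by
      rw [hg.integral_const_add hpq, hint]; simp, rfl⟩
    simp only [add_neg_cancel_left] at h1
    have h2 : ⨍ x in cell x₀ v, L x (ξ + G x) (g x) =
        ⨍ x in cell x₀ v, inner ℝ (ξ + G x) (g x) := by
      rw [setAverage_eq, setAverage_eq]
      congr 1
      refine integral_congr_ae ?_
      filter_upwards [hmem, hβ] with x hx hx'
      rw [hx'] at hx
      exact sub_eq_zero.1 hx
    rw [h2, hpair φ G g hG hg] at h1
    exact sub_eq_zero.2 (le_antisymm h1 (hsd.inner_le ξ η))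
  · intro hη
    -- At a minimizer, L ≥ ⟨·, ·⟩ holds pointwise while both sides have the same integral; so they
    -- agree almost everywhere, and η + g lies in the field of L along ξ + ∇φ.
    obtain ⟨φ, G, g, hG, hg, h0, he⟩ := (hmin ξ η).1
    have hw := hg.const_add hpq η
    have hmean : ∫ x in cell x₀ v, (η + g x) = volume.real (cell x₀ v) • η := by
      rw [hg.integral_const_add hpq, h0, add_zero]
    have havg : ⨍ x in cell x₀ v, (η + g x) = η := by
      rw [setAverage_eq, hmean, inv_smul_smul₀ hV.ne']
    have h1 : LHom x₀ v p q L ξ η = inner ℝ ξ η := sub_eq_zero.1 hη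
    have h2 := hpair φ G _ hG hw
    rw [havg, ← h1, he, setAverage_eq, setAverage_eq] at h2
    have h3 := smul_right_injective ℝ (inv_ne_zero hV.ne') h2
    have m1 := memLp_const_add ξ hG.memLp_grad
    have i1 := hL.integrable hpq m1 hw.memLp
    have i2 := integrable_inner_of_conj hpq m1 hw.memLp
    have hle : (fun x => inner ℝ (ξ + G x) (η + g x)) ≤ᵐ[volume.restrict (cell x₀ v)]
        fun x => L x (ξ + G x) (η + g x) := by
      filter_upwards [hL.selfdual] with x hx using hx.inner_le _ _
    have heq := (integral_eq_iff_of_ae_le i2 i1 hle).1 h3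
    refine ⟨_, φ, G, hw, hG, ?_, havg.symm⟩
    filter_upwards [heq, hβ] with x hx hx'
    rw [hx']
    exact sub_eq_zero.2 hx.symm

end CellProblem

end PeriodicHom

end

theorem theorem3p2 {N : ℕ} (Ω : Set (PeriodicHom.Eu N)) (hΩo : IsOpen Ω) (hΩc : IsConnected Ω)
    (p q : ℝ) (hp : 1 < p) (hpq : 1 / p + 1 / q = 1)
    (x₀ : PeriodicHom.Eu N) (v : Module.Basis (Fin N) ℝ (PeriodicHom.Eu N))
    (hQ : PeriodicHom.cell x₀ v ⊆ Ω)
    (β : PeriodicHom.Eu N → PeriodicHom.Eu N → Set (PeriodicHom.Eu N))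
    (hβ : PeriodicHom.MemM Ω p q β)
    (hper : PeriodicHom.IsCellPeriodicOn Ω v β)
    (L : PeriodicHom.Eu N → PeriodicHom.Eu N → PeriodicHom.Eu N → ℝ)
    (hL : PeriodicHom.IsSelfdualLagrangianOn Ω L)
    (hgrowth : PeriodicHom.HasGrowth Ω p q L)
    (hrep : ∀ᵐ x ∂(volume.restrict Ω), ∀ ξ, β x ξ = PeriodicHom.selfdualField (L x) ξ) :
    -- the cell averages of all competitors are averages of integrable functions
    (∀ (ξ η : PeriodicHom.Eu N) (φ : PeriodicHom.Eu N → ℝ)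
        (G g : PeriodicHom.Eu N → PeriodicHom.Eu N),
      PeriodicHom.IsPeriodicSobolev x₀ v p φ G → PeriodicHom.IsPeriodicDivFree x₀ v p q g →
      IntegrableOn (fun x => L x (ξ + G x) (η + g x)) (PeriodicHom.cell x₀ v) volume) ∧
    -- the homogenized Lagrangian is an attained minimum
    (∀ ξ η : PeriodicHom.Eu N,
      IsLeast (PeriodicHom.cellEnergies x₀ v p q L ξ η) (PeriodicHom.LHom x₀ v p q L ξ η)) ∧
    PeriodicHom.IsSelfdualLagrangian (PeriodicHom.LHom x₀ v p q L) ∧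
    (∀ ξ : PeriodicHom.Eu N, PeriodicHom.betaHom x₀ v p q β ξ =
      PeriodicHom.selfdualField (PeriodicHom.LHom x₀ v p q L) ξ) := by
  have hpq' : p.HolderConjugate q := Real.holderConjugate_iff.2 ⟨hp, by simpa using hpq⟩
  have hI := PeriodicHom.isSelfdualIntegrand_cell hQ hL hgrowth
  have hmin : ∀ ξ η, IsLeast (PeriodicHom.cellEnergies x₀ v p q L ξ η)
      (PeriodicHom.LHom x₀ v p q L ξ η) := fun ξ η =>
    (PeriodicHom.isLeast_and_isLUB_of_duality PeriodicHom.cellEnergies_nonempty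
      (PeriodicHom.cellEnergies_weak hpq' hI) (PeriodicHom.cellEnergies_strong hpq' hI) ξ η).1
  have hsd : PeriodicHom.IsSelfdualLagrangian (PeriodicHom.LHom x₀ v p q L) :=
    PeriodicHom.isSelfdualLagrangian_sInf_of_duality PeriodicHom.cellEnergies_nonempty
      (PeriodicHom.cellEnergies_weak hpq' hI) (PeriodicHom.cellEnergies_strong hpq' hI)
  exact ⟨fun ξ η φ G g hG hg => hI.integrable hpq' (PeriodicHom.memLp_const_add ξ hG.memLp_grad)
      (PeriodicHom.memLp_const_add η hg.memLp), hmin, hsd,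
    PeriodicHom.betaHom_eq_selfdualField hpq' hI hmin hsd
      (ae_restrict_of_ae_restrict_of_subset hQ hrep)⟩
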